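/- Let $n,l,J\ge 0$ and $m_1,\dots,m_J\ge 1$ be integers, $m=\sum_{i=1}^J m_i$. Let $\mathcal K_i=\{(x_1,x_2)\in\mathbb R\times\mathbb R^{m_i-1}: x_1\ge\|x_2\|\}$ be the $m_i$-dimensional second-order cone, $\mathcal K=\mathcal K_1\times\dots\times\mathcal K_J\subseteq\mathbb R^m$, and set $$\Omega_i=\{(x,y): x\in\mathcal K_i,\ y\in\mathcal K_i,\ x^Ty=0\},\qquad \Omega=\{(x,y): x\in\mathcal K,\ y\in\mathcal K,\ x^Ty=0\}.$$ Let $F:\mathbb R^n\to\mathbb R^l$, $G=(G_1,\dots,G_J)$ and $H=(H_1,\dots,H_J):\mathbb R^n\to\mathbb R^{m}$ be continuously differentiable, with $G_i,H_i:\mathbb R^n\to\mathbb R^{m_i}$, and let $\Lambda\subseteq\mathbb R^l$ be closed. Let $\mathcal F$ be the solution set of the second-order cone complementarity system $$\mathcal K\ni G(z)\perp H(z)\in\mathcal K,\qquad F(z)\in\Lambda,$$ and let $z^*\in\mathcal F$. For a set $C$ in a Euclidean space and $z\in C$, the tangent cone is $T_C(z)=\{u:\exists\, t_k\downarrow 0,\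 u_k\to u,\ z+t_ku_k\in C\ \forall k\}$; the regular normal cone is $\widehat N_C(z)=\{v:\langle v,z'-z\rangle\le o(\|z'-z\|)\text{ for } z'\in C\}$, with $\widehat N_C(z)=\emptyset$ if $z\notin C$; the limiting normal cone in direction $d$ is $$N_C(z;d)=\{v:\exists\, t_k\downarrow0,\ d_k\to d,\ v_k\to v,\ v_k\in\widehat N_C(z+t_kd_k)\ \forall k\};$$ and the inner limiting normal cone in direction $d$ is $$N^i_C(z;d)=\{v:\forall\, t_k\downarrow0\ \exists\, d_k\to d,\ v_k\to v,\ v_k\in\widehat N_C(z+t_kd_k)\ \forall k\}.$$ The set $C$ is directionally regular if $N_C(z;d)=N_C^i(z;d)$ for all $z\in C$ and all $d$. Consider the following two conditions. (A) For every $w\neq0$ in $\mathbb R^n$ with $\nabla F(z^*)w\in T_\Lambda(F(z^*))$ and $(\nabla G_i(z^*)w,\nabla H_i(z^*)w)\in T_{\Omega_i}(G_i(z^*),H_i(z^*))$, $i=1,\dots,J$, the only multipliers $\lambda^F\in\mathbb{R}^l$, $\lambda^G=(\lambda^G_1,\dots,\lambda^G_J)$, $\lambda^H=(\lambda^H_1,\dots,\lambda^H_J)\in\mathbb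 R^m$ with $$\nabla F(z^*)^T\lambda^F+\sum_{i=1}^J\{\nabla G_i(z^*)^T\lambda_i^G+\nabla H_i(z^*)^T\lambda_i^H\}=0,\quad \lambda^F\in N_\Lambda(F(z^*);\nabla F(z^*)w),$$ $$(\lambda_i^G,\lambda_i^H)\in N_{\Omega_i}\big((G_i(z^*),H_i(z^*));(\nabla G_i(z^*)w,\nabla H_i(z^*)w)\big),\quad i=1,\dots,J,$$ are $(\lambda^F,\lambda^G,\lambda^H)=0$. (B) For every $w\neq0$ in $\mathbb R^n$ with $\nabla F(z^*)w\in T_\Lambda(F(z^*))$ and $(\nabla G(z^*)w,\nabla H(z^*)w)\in T_{\Omega}(G(z^*),H(z^*))$, the only multipliers $\lambda^F\in\mathbb{R}^l$ and $\lambda^G,\lambda^H\in\mathbb R^m$ with $$\nabla F(z^*)^T\lambda^F+\nabla G(z^*)^T\lambda^G+\nabla H(z^*)^T\lambda^H=0,\quad \lambda^F\in N_\Lambda(F(z^*);\nabla F(z^*)w),$$ $$(\lambda^G,\lambda^H)\in N_{\Omega}\big((G(z^*),H(z^*));(\nabla G(z^*)w,\nabla H(z^*)w)\big)$$ are $(\lambda^F,\lambda^G,\lambda^H)=0$.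 Then: 1. If (A) holds, the system has a local error bound at $z^*$: there are $\kappa>0$ and a neighborhood $U$ of $z^*$ such that $$d(z,\mathcal F)\le\kappa\Big\{d_\Lambda(F(z))+\sum_{i=1}^J d_{\Omega_i}(G_i(z),H_i(z))\Big\}\qquad\forall z\in U.$$ 2. Conditions (A) and (B) are equivalent (so (B) also implies the local error bound). 3. The set $\Omega$ is directionally regular. -/

import Mathlib

open Filter Topology

noncomputable section

section VariationalAnalysis

variable {V : Type*} [NormedAddCommGroup V] [InnerProductSpace ℝ V]

/-- A sequence of positive reals converging to zero, `t_k ↓ 0`. -/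
def PosTendsToZero (t : ℕ → ℝ) : Prop :=
  (∀ k, 0 < t k) ∧ Tendsto t atTop (𝓝 0)

/-- The (Bouligand) tangent cone `T_C(z)`, for a point `z ∈ C`. -/
def TangentCone (C : Set V) (z : V) : Set V :=
  {u | ∃ (t : ℕ → ℝ) (u' : ℕ → V), PosTendsToZero t ∧ Tendsto u' atTop (𝓝 u) ∧
    ∀ k, z + t k • u' k ∈ C}

/-- The regular (Fréchet) normal cone: `⟪v, z' - z⟫ ≤ o(‖z' - z‖)` for `z' ∈ C`.
It is empty when `z ∉ C`. -/
def RegularNormalCone (C : Set V) (z : V) : Set V :=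
  {v | z ∈ C ∧ ∀ ε : ℝ, 0 < ε → ∀ᶠ z' in 𝓝[C] z, inner ℝ v (z' - z) ≤ ε * ‖z' - z‖}

/-- The limiting normal cone `N_C(z; d)` to `C` at `z` in direction `d`. -/
def DirectionalNormalCone (C : Set V) (z d : V) : Set V :=
  {v | ∃ (t : ℕ → ℝ) (d' v' : ℕ → V), PosTendsToZero t ∧
    Tendsto d' atTop (𝓝 d) ∧ Tendsto v' atTop (𝓝 v) ∧
    ∀ k, v' k ∈ RegularNormalCone C (z + t k • d' k)}

/-- The inner limiting normal cone `Nⁱ_C(z; d)` to `C` at `z` in direction `d`. -/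
def InnerDirectionalNormalCone (C : Set V) (z d : V) : Set V :=
  {v | ∀ t : ℕ → ℝ, PosTendsToZero t → ∃ d' v' : ℕ → V,
    Tendsto d' atTop (𝓝 d) ∧ Tendsto v' atTop (𝓝 v) ∧
    ∀ k, v' k ∈ RegularNormalCone C (z + t k • d' k)}

/-- `C` is directionally regular: at each of its points and in each direction, the directional
normal cone and the inner directional normal cone coincide. -/
def DirectionallyRegular (C : Set V) : Prop :=
  ∀ z ∈ C, ∀ d : V, DirectionalNormalCone C z d = InnerDirectionalNormalCone C z d

/-- The complementarity set `{(x, y) | K ∋ x ⊥ y ∈ K}` in the Euclidean product `V × V`. -/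
def ComplementaritySet (K : Set V) : Set (WithLp 2 (V × V)) :=
  {q | q.fst ∈ K ∧ q.snd ∈ K ∧ inner ℝ q.fst q.snd = 0}

end VariationalAnalysis

/-- The second-order cone `{(x₁, x₂) ∈ ℝ × ℝ^p | x₁ ≥ ‖x₂‖}` of dimension `p + 1`. -/
def SecondOrderCone (p : ℕ) : Set (EuclideanSpace ℝ (Fin (p + 1))) :=
  {x | ‖(WithLp.toLp 2 (fun j : Fin p => x j.succ) : EuclideanSpace ℝ (Fin p))‖ ≤ x 0}

/-- The Euclidean space `ℝ^m = ℝ^{m_1} × ⋯ × ℝ^{m_J}`, where `m_i = p i + 1`. -/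
abbrev BlockSpace {J : ℕ} (p : Fin J → ℕ) : Type :=
  PiLp 2 (fun i : Fin J => EuclideanSpace ℝ (Fin (p i + 1)))

/-- The product `K = K_1 × ⋯ × K_J` of second-order cones, `K_i` of dimension `p i + 1`. -/
def ProductCone {J : ℕ} (p : Fin J → ℕ) : Set (BlockSpace p) :=
  {x | ∀ i, x i ∈ SecondOrderCone (p i)}

section System

variable {n l J : ℕ} {p : Fin J → ℕ}

/-- The solution set of the system `K ∋ G(z) ⊥ H(z) ∈ K`, `F(z) ∈ Λ`. -/
def SolutionSet (F : EuclideanSpace ℝ (Fin n) → EuclideanSpace ℝ (Fin l))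
    (G H : EuclideanSpace ℝ (Fin n) → BlockSpace p) (Λ : Set (EuclideanSpace ℝ (Fin l))) :
    Set (EuclideanSpace ℝ (Fin n)) :=
  {z | G z ∈ ProductCone p ∧ H z ∈ ProductCone p ∧ inner ℝ (G z) (H z) = 0 ∧ F z ∈ Λ}

/-- The system has a local error bound at `zs`. -/
def HasLocalErrorBound (F : EuclideanSpace ℝ (Fin n) → EuclideanSpace ℝ (Fin l))
    (G H : EuclideanSpace ℝ (Fin n) → BlockSpace p) (Λ : Set (EuclideanSpace ℝ (Fin l)))
    (zs : EuclideanSpace ℝ (Fin n)) : Prop :=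
  ∃ κ : ℝ, 0 < κ ∧ ∃ U ∈ 𝓝 zs, ∀ z ∈ U,
    Metric.infDist z (SolutionSet F G H Λ) ≤
      κ * (Metric.infDist (F z) Λ +
        ∑ i, Metric.infDist (WithLp.toLp 2 (G z i, H z i))
          (ComplementaritySet (SecondOrderCone (p i))))

/-- The first-order sufficient condition, componentwise form (with the sets `Ω_i`). -/
def ComponentwiseFOSCMS (F : EuclideanSpace ℝ (Fin n) → EuclideanSpace ℝ (Fin l))
    (G H : EuclideanSpace ℝ (Fin n) → BlockSpace p) (Λ : Set (EuclideanSpace ℝ (Fin l)))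
    (zs : EuclideanSpace ℝ (Fin n)) : Prop :=
  ∀ w : EuclideanSpace ℝ (Fin n), w ≠ 0 →
    fderiv ℝ F zs w ∈ TangentCone Λ (F zs) →
    (∀ i, WithLp.toLp 2 (fderiv ℝ (fun z => G z i) zs w, fderiv ℝ (fun z => H z i) zs w) ∈
      TangentCone (ComplementaritySet (SecondOrderCone (p i)))
        (WithLp.toLp 2 (G zs i, H zs i))) →
    ∀ (lF : EuclideanSpace ℝ (Fin l)) (lG lH : BlockSpace p),
      (fderiv ℝ F zs).adjoint lF +
        ∑ i, ((fderiv ℝ (fun z => G z i) zs).adjoint (lG i) +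
          (fderiv ℝ (fun z => H z i) zs).adjoint (lH i)) = 0 →
      lF ∈ DirectionalNormalCone Λ (F zs) (fderiv ℝ F zs w) →
      (∀ i, WithLp.toLp 2 (lG i, lH i) ∈
        DirectionalNormalCone (ComplementaritySet (SecondOrderCone (p i)))
          (WithLp.toLp 2 (G zs i, H zs i))
          (WithLp.toLp 2 (fderiv ℝ (fun z => G z i) zs w, fderiv ℝ (fun z => H z i) zs w))) →
      lF = 0 ∧ lG = 0 ∧ lH = 0

/-- The first-order sufficient condition, joint form (with `Ω = {(x, y) | K ∋ x ⊥ y ∈ K}`). -/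
def JointFOSCMS (F : EuclideanSpace ℝ (Fin n) → EuclideanSpace ℝ (Fin l))
    (G H : EuclideanSpace ℝ (Fin n) → BlockSpace p) (Λ : Set (EuclideanSpace ℝ (Fin l)))
    (zs : EuclideanSpace ℝ (Fin n)) : Prop :=
  ∀ w : EuclideanSpace ℝ (Fin n), w ≠ 0 →
    fderiv ℝ F zs w ∈ TangentCone Λ (F zs) →
    WithLp.toLp 2 (fderiv ℝ G zs w, fderiv ℝ H zs w) ∈
      TangentCone (ComplementaritySet (ProductCone p)) (WithLp.toLp 2 (G zs, H zs)) →
    ∀ (lF : EuclideanSpace ℝ (Fin l)) (lG lH : BlockSpace p),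
      (fderiv ℝ F zs).adjoint lF + (fderiv ℝ G zs).adjoint lG + (fderiv ℝ H zs).adjoint lH = 0 →
      lF ∈ DirectionalNormalCone Λ (F zs) (fderiv ℝ F zs w) →
      WithLp.toLp 2 (lG, lH) ∈
        DirectionalNormalCone (ComplementaritySet (ProductCone p))
          (WithLp.toLp 2 (G zs, H zs)) (WithLp.toLp 2 (fderiv ℝ G zs w, fderiv ℝ H zs w)) →
      lF = 0 ∧ lG = 0 ∧ lH = 0

end System

end

/-! Everything rests on the directional regularity of Ω. A set which near a point is invariant under
dilations centered there has the same limiting normals for all step sizes: rescaling by `s k / t k`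
carries one sequence of base points to the other and preserves regular normals
(`LocallyConicAt.directionallyRegularAt`). The property is also stable under local C¹ charts
(`DirectionallyRegularAt.of_chart`).

For one cone, write x₀, y₀ for the coordinates along the axis and x̄, ȳ for the orthogonal parts.
Where x̄ ≠ 0, the shear (x, y) ↦ (x - ‖x̄‖e, y + (y₀/‖x̄‖)x̄) turns the complementarity set into the
polyhedral set a ≥ 0, b ≥ 0, ab = 0, ȳ = 0. If x̄ = 0 ≠ x, then x is interior and y = 0 nearby; if x
= 0 ≠ y, exchange x and y; at the origin the set is a cone.

Since each cone is self-dual, Ω is a product of the Ω_i up to reordering coordinates. Normals along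
a fixed step sequence always split into blocks; regularity allows blocks with different step sizes
to be synchronized, so directional normal cones split too. This gives (A) ⇔ (B).

The error bound is obtained by contradiction. Penalizing the residual by the distance to bad points,
as in Ekeland's principle, produces unit normals v_k to D = Λ × Ω with ∇g(x_k)ᵀv_k → 0, where g =
(F, (G, H)). A limit along x_k → z* violates (B) in the direction approached by x_k - z*. -/

section VariationalCalculus

variable {V W : Type*} [NormedAddCommGroup V] [InnerProductSpace ℝ V]
  [NormedAddCommGroup W] [InnerProductSpace ℝ W]

/-! ### Calculus of regular normals -/

theorem zero_mem_regularNormalCone {C : Set V} {z : V} (hz : z ∈ C) :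
    (0 : V) ∈ RegularNormalCone C z := by
  refine ⟨hz, fun ε hε => Eventually.of_forall fun z' => ?_⟩
  rw [inner_zero_left]
  positivity

theorem add_mem_regularNormalCone {C : Set V} {z v w : V} (hv : v ∈ RegularNormalCone C z)
    (hw : w ∈ RegularNormalCone C z) : v + w ∈ RegularNormalCone C z := by
  refine ⟨hv.1, fun ε hε => ?_⟩
  filter_upwards [hv.2 (ε / 2) (half_pos hε), hw.2 (ε / 2) (half_pos hε)] with z' h1 h2
  rw [inner_add_left]
  linarith

theorem sum_mem_regularNormalCone {ι : Type*} {C : Set V} {z : V} (hz : z ∈ C) (s : Finset ι)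
    {v : ι → V} (hv : ∀ i ∈ s, v i ∈ RegularNormalCone C z) :
    ∑ i ∈ s, v i ∈ RegularNormalCone C z := by
  classical
  induction s using Finset.induction_on with
  | empty => simpa using zero_mem_regularNormalCone hz
  | insert a s ha ih =>
    rw [Finset.sum_insert ha]
    exact add_mem_regularNormalCone (hv a (Finset.mem_insert_self a s))
      (ih fun i hi => hv i (Finset.mem_insert_of_mem hi))

theorem smul_mem_regularNormalCone {C : Set V} {z v : V} {c : ℝ} (hc : 0 < c)
    (hv : v ∈ RegularNormalCone C z) : c • v ∈ RegularNormalCone C z := by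
  refine ⟨hv.1, fun ε hε => ?_⟩
  filter_upwards [hv.2 (ε / c) (div_pos hε hc)] with z' h
  rw [real_inner_smul_left]
  calc c * inner ℝ v (z' - z) ≤ c * (ε / c * ‖z' - z‖) := by gcongr
    _ = ε * ‖z' - z‖ := by field_simp

/-- Regular normals pull back along a differentiable map sending `P` locally into `C`. -/
theorem adjoint_mem_regularNormalCone [CompleteSpace V] [CompleteSpace W] {f : W → V}
    {f' : W →L[ℝ] V} {P : Set W} {C : Set V} {w : W} {v : V} (hf : HasFDerivAt f f' w)
    (hw : w ∈ P) (hPC : ∀ᶠ w' in 𝓝 w, w' ∈ P → f w' ∈ C) (hv : v ∈ RegularNormalCone C (f w)) :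
    f'.adjoint v ∈ RegularNormalCone P w := by
  refine ⟨hw, fun ε hε => ?_⟩
  have ht : Tendsto f (𝓝[P] w) (𝓝[C] (f w)) := by
    refine tendsto_nhdsWithin_iff.2 ⟨hf.continuousAt.tendsto.mono_left nhdsWithin_le_nhds, ?_⟩
    filter_upwards [nhdsWithin_le_nhds hPC, self_mem_nhdsWithin] with w' h1 h2 using h1 h2
  have hδ : 0 < min 1 (ε / (2 * (‖v‖ + 1))) := by positivity
  have h2 := nhdsWithin_le_nhds (s := P) (hf.isLittleO.def hδ)
  have h1 := ht.eventually (hv.2 (ε / (2 * (‖f'‖ + 1))) (by positivity))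
  filter_upwards [h1, h2] with w' h1 h2
  set r := f w' - f w - f' (w' - w)
  have hr1 : ‖r‖ ≤ ‖w' - w‖ :=
    h2.trans (mul_le_of_le_one_left (norm_nonneg _) (min_le_left _ _))
  have hr2 : ‖r‖ ≤ ε / (2 * (‖v‖ + 1)) * ‖w' - w‖ :=
    h2.trans (mul_le_mul_of_nonneg_right (min_le_right _ _) (norm_nonneg _))
  have e : f w' - f w = f' (w' - w) + r := by simp [r]
  have hfn : ‖f w' - f w‖ ≤ (‖f'‖ + 1) * ‖w' - w‖ := by
    rw [e]
    linarith [norm_add_le (f' (w' - w)) r, f'.le_opNorm (w' - w)]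
  rw [ContinuousLinearMap.adjoint_inner_left,
    show f' (w' - w) = (f w' - f w) - r by simp [r], inner_sub_right]
  have h3 : -inner ℝ v r ≤ ‖v‖ * ‖r‖ := (neg_le_abs _).trans (abs_real_inner_le_norm v r)
  have h4 : ε / (2 * (‖f'‖ + 1)) * ‖f w' - f w‖ ≤ ε / 2 * ‖w' - w‖ := by
    calc _ ≤ ε / (2 * (‖f'‖ + 1)) * ((‖f'‖ + 1) * ‖w' - w‖) := by gcongr
      _ = _ := by field_simp
  have h5 : ‖v‖ * ‖r‖ ≤ ε / 2 * ‖w' - w‖ := by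
    calc _ ≤ (‖v‖ + 1) * (ε / (2 * (‖v‖ + 1)) * ‖w' - w‖) := by gcongr; linarith
      _ = _ := by field_simp
  linarith

/-! ### Limiting normals, step sizes and charts -/

/-- `v` is a limit of regular normals to `C` at points `z + t_k d_k` with `d_k → d`. -/
def IsNormalAlong (C : Set V) (z : V) (t : ℕ → ℝ) (d v : V) : Prop :=
  ∃ d' v' : ℕ → V, Tendsto d' atTop (𝓝 d) ∧ Tendsto v' atTop (𝓝 v) ∧
    ∀ᶠ k in atTop, v' k ∈ RegularNormalCone C (z + t k • d' k)

/-- Being a limiting normal at `z` in a direction does not depend on the step sizes. -/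
def DirectionallyRegularAt (C : Set V) (z : V) : Prop :=
  ∀ t s : ℕ → ℝ, PosTendsToZero t → PosTendsToZero s → ∀ d v : V,
    IsNormalAlong C z t d v → IsNormalAlong C z s d v

theorem posTendsToZero_one_div : PosTendsToZero fun k : ℕ => 1 / ((k : ℝ) + 1) :=
  ⟨fun _ => by positivity, tendsto_one_div_add_atTop_nhds_zero_nat⟩

theorem PosTendsToZero.comp {t : ℕ → ℝ} (ht : PosTendsToZero t) {φ : ℕ → ℕ}
    (hφ : StrictMono φ) : PosTendsToZero (t ∘ φ) :=
  ⟨fun _ => ht.1 _, ht.2.comp hφ.tendsto_atTop⟩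

theorem IsNormalAlong.exists_forall {C : Set V} {z : V} (hz : z ∈ C) {t : ℕ → ℝ} {d v : V}
    (h : IsNormalAlong C z t d v) :
    ∃ d' v' : ℕ → V, Tendsto d' atTop (𝓝 d) ∧ Tendsto v' atTop (𝓝 v) ∧
      ∀ k, v' k ∈ RegularNormalCone C (z + t k • d' k) := by
  classical
  obtain ⟨d', v', hd, hv, hN⟩ := h
  -- At the finitely many bad indices, use the base point `z` itself with normal 0; this does not
  -- affect the limits.
  refine ⟨fun k => if v' k ∈ RegularNormalCone C (z + t k • d' k) then d' k else 0,
    fun k => if v' k ∈ RegularNormalCone C (z + t k • d' k) then v' k else 0, ?_, ?_, ?_⟩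
  · refine hd.congr' ?_
    filter_upwards [hN] with k hk
    rw [if_pos hk]
  · refine hv.congr' ?_
    filter_upwards [hN] with k hk
    rw [if_pos hk]
  · intro k
    by_cases hk : v' k ∈ RegularNormalCone C (z + t k • d' k)
    · simp [hk]
    · simp [hk, zero_mem_regularNormalCone hz]

theorem mem_directionalNormalCone_iff {C : Set V} {z d v : V} (hz : z ∈ C) :
    v ∈ DirectionalNormalCone C z d ↔ ∃ t, PosTendsToZero t ∧ IsNormalAlong C z t d v := by
  constructor
  · rintro ⟨t, d', v', ht, hd, hv, h⟩
    exact ⟨t, ht, d', v', hd, hv, Eventually.of_forall h⟩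
  · rintro ⟨t, ht, h⟩
    obtain ⟨d', v', hd, hv, h⟩ := h.exists_forall hz
    exact ⟨t, d', v', ht, hd, hv, h⟩

theorem DirectionallyRegularAt.directionalNormalCone_eq {C : Set V} {z : V} (hz : z ∈ C)
    (h : DirectionallyRegularAt C z) (d : V) :
    DirectionalNormalCone C z d = InnerDirectionalNormalCone C z d := by
  ext v
  constructor
  · intro hv s hs
    obtain ⟨t, ht, hN⟩ := (mem_directionalNormalCone_iff hz).1 hv
    exact (h t s ht hs d v hN).exists_forall hz
  · intro hv
    obtain ⟨d', v', hd, hv', hN⟩ := hv _ posTendsToZero_one_div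
    exact ⟨_, d', v', posTendsToZero_one_div, hd, hv', hN⟩

theorem mem_tangentCone_of_mem_directionalNormalCone {C : Set V} {z d v : V}
    (h : v ∈ DirectionalNormalCone C z d) : d ∈ TangentCone C z := by
  obtain ⟨t, d', v', ht, hd, -, hN⟩ := h
  exact ⟨t, d', ht, hd, fun k => (hN k).1⟩

theorem PosTendsToZero.tendsto_add_smul {t : ℕ → ℝ} (ht : PosTendsToZero t) {z d : V}
    {d' : ℕ → V} (hd : Tendsto d' atTop (𝓝 d)) :
    Tendsto (fun k => z + t k • d' k) atTop (𝓝 z) := by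
  simpa using tendsto_const_nhds.add (ht.2.smul hd)

theorem PosTendsToZero.tendsto_difference_quotient {t : ℕ → ℝ} (ht : PosTendsToZero t)
    {f : V → W} {f' : V →L[ℝ] W} {z d : V} (hf : HasFDerivAt f f' z)
    {d' : ℕ → V} (hd : Tendsto d' atTop (𝓝 d)) :
    Tendsto (fun k => (t k)⁻¹ • (f (z + t k • d' k) - f z)) atTop (𝓝 (f' d)) := by
  have h0 : Tendsto (fun k => t k • d' k) atTop (𝓝 0) := by simpa using ht.2.smul hd
  refine (hasFDerivWithinAt_univ.2 hf).lim h0 (Eventually.of_forall fun _ => Set.mem_univ _) ?_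
  refine hd.congr fun k => ?_
  rw [inv_smul_smul₀ (ht.1 k).ne']

theorem tendsto_clm_apply {ι : Type*} {l : Filter ι} {A : ι → V →L[ℝ] W} {A₀ : V →L[ℝ] W}
    {v : ι → V} {v₀ : V} (hA : Tendsto A l (𝓝 A₀)) (hv : Tendsto v l (𝓝 v₀)) :
    Tendsto (fun k => A k (v k)) l (𝓝 (A₀ v₀)) :=
  ((isBoundedBilinearMap_apply (𝕜 := ℝ) (E := V) (F := W)).continuous.tendsto (A₀, v₀)).comp
    (hA.prodMk_nhds hv)

/-- The step sizes are kept: the new directions are difference quotients of `Φ`. Normals are pulled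
back along the inverse chart `Ψ` at the moving base points, and their limit exists because the
derivative of `Ψ` is continuous. -/
theorem IsNormalAlong.map [CompleteSpace V] [CompleteSpace W] {C : Set V} {P : Set W} {z : V}
    {Φ : V → W} {Ψ : W → V} {t : ℕ → ℝ} (ht : PosTendsToZero t) {d v : V}
    (hΦ : DifferentiableAt ℝ Φ z) (hΨ : ContDiffAt ℝ 1 Ψ (Φ z))
    (hΨΦ : ∀ᶠ u in 𝓝 z, Ψ (Φ u) = u) (hCP : ∀ᶠ u in 𝓝 z, u ∈ C → Φ u ∈ P)
    (hPC : ∀ᶠ w in 𝓝 (Φ z), w ∈ P → Ψ w ∈ C) (h : IsNormalAlong C z t d v) :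
    IsNormalAlong P (Φ z) t (fderiv ℝ Φ z d) ((fderiv ℝ Ψ (Φ z)).adjoint v) := by
  obtain ⟨d', v', hd, hv, hN⟩ := h
  have hu := ht.tendsto_add_smul (z := z) hd
  have hw : Tendsto (fun k => Φ (z + t k • d' k)) atTop (𝓝 (Φ z)) := hΦ.continuousAt.tendsto.comp hu
  have hadj : Tendsto (fun k => (fderiv ℝ Ψ (Φ (z + t k • d' k))).adjoint (v' k)) atTop
      (𝓝 ((fderiv ℝ Ψ (Φ z)).adjoint v)) := by
    have h1 : Tendsto (fun k => fderiv ℝ Ψ (Φ (z + t k • d' k))) atTop (𝓝 (fderiv ℝ Ψ (Φ z))) :=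
      (hΨ.continuousAt_fderiv one_ne_zero).tendsto.comp hw
    have h2 : Tendsto (fun k => (fderiv ℝ Ψ (Φ (z + t k • d' k))).adjoint) atTop
        (𝓝 (fderiv ℝ Ψ (Φ z)).adjoint) := (ContinuousLinearMap.adjoint.continuous.tendsto _).comp h1
    exact tendsto_clm_apply h2 hv
  refine ⟨fun k => (t k)⁻¹ • (Φ (z + t k • d' k) - Φ z), _,
    ht.tendsto_difference_quotient hΦ.hasFDerivAt hd, hadj, ?_⟩
  have hdiff : ∀ᶠ w in 𝓝 (Φ z), DifferentiableAt ℝ Ψ w :=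
    (hΨ.eventually (by simp)).mono fun w hw => hw.differentiableAt one_ne_zero
  filter_upwards [hN, hu.eventually hΨΦ, hu.eventually hCP,
    hw.eventually hPC.eventually_nhds, hw.eventually hdiff] with k hNk h1 h2 h3 h4
  rw [smul_inv_smul₀ (ht.1 k).ne', add_sub_cancel]
  exact adjoint_mem_regularNormalCone h4.hasFDerivAt (h2 hNk.1) h3 (by rwa [h1])

/-- Directional regularity is invariant under local `C¹` diffeomorphisms. -/
theorem DirectionallyRegularAt.of_chart [CompleteSpace V] [CompleteSpace W] {C : Set V}
    {P : Set W} {z : V} {Φ : V → W} {Ψ : W → V} (hΦ : ContDiffAt ℝ 1 Φ z)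
    (hΨ : ContDiffAt ℝ 1 Ψ (Φ z)) (hΨΦ : ∀ᶠ u in 𝓝 z, Ψ (Φ u) = u)
    (hΦΨ : ∀ᶠ w in 𝓝 (Φ z), Φ (Ψ w) = w) (hCP : ∀ᶠ u in 𝓝 z, u ∈ C → Φ u ∈ P)
    (hPC : ∀ᶠ w in 𝓝 (Φ z), w ∈ P → Ψ w ∈ C) (h : DirectionallyRegularAt P (Φ z)) :
    DirectionallyRegularAt C z := by
  intro t s ht hs d v hN
  have hz : Ψ (Φ z) = z := hΨΦ.self_of_nhds
  have hdΦ := hΦ.differentiableAt one_ne_zero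
  have hdΨ := hΨ.differentiableAt one_ne_zero
  have h1 := h t s ht hs _ _ (hN.map ht hdΦ hΨ hΨΦ hCP hPC)
  -- Return with the charts exchanged; the chain rule for `Ψ ∘ Φ` then restores `d` and `v`.
  have h2 := h1.map hs hdΨ (by rwa [hz]) hΦΨ hPC (by rwa [hz])
  have hcomp : (fderiv ℝ Ψ (Φ z)).comp (fderiv ℝ Φ z) = ContinuousLinearMap.id ℝ V :=
    (hdΨ.hasFDerivAt.comp z hdΦ.hasFDerivAt).unique
      ((hasFDerivAt_id z).congr_of_eventuallyEq hΨΦ)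
  have e1 : fderiv ℝ Ψ (Φ z) (fderiv ℝ Φ z d) = d := by
    simpa using congrArg (fun L : V →L[ℝ] V => L d) hcomp
  have e2 : (fderiv ℝ Φ z).adjoint ((fderiv ℝ Ψ (Φ z)).adjoint v) = v := by
    refine ext_inner_right ℝ fun u => ?_
    rw [ContinuousLinearMap.adjoint_inner_left, ContinuousLinearMap.adjoint_inner_left]
    congr 1
    simpa using congrArg (fun L : V →L[ℝ] V => L u) hcomp
  rwa [hz, e1, e2] at h2

/-- Near `z`, the set `C` is invariant under positive dilations with center `z`. -/
def LocallyConicAt (C : Set V) (z : V) : Prop :=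
  ∃ r > 0, ∀ u : V, ‖u‖ < r → ∀ τ : ℝ, 0 < τ → ‖τ • u‖ < r → z + u ∈ C → z + τ • u ∈ C

theorem LocallyConicAt.directionallyRegularAt [CompleteSpace V] {C : Set V} {z : V}
    (h : LocallyConicAt C z) : DirectionallyRegularAt C z := by
  obtain ⟨r, hr, h⟩ := h
  have key : ∀ u v : V, ‖u‖ < r → ∀ τ : ℝ, 0 < τ → ‖τ • u‖ < r →
      v ∈ RegularNormalCone C (z + u) → v ∈ RegularNormalCone C (z + τ • u) := by
    intro u v hu τ hτ hτu hv
    have hf : HasFDerivAt (fun w : V => z + τ⁻¹ • (w - z)) (τ⁻¹ • ContinuousLinearMap.id ℝ V)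
        (z + τ • u) := (((hasFDerivAt_id _).sub_const z).const_smul τ⁻¹).const_add z
    have e : z + τ⁻¹ • (z + τ • u - z) = z + u := by
      rw [add_sub_cancel_left, inv_smul_smul₀ hτ.ne']
    have ev1 : ∀ᶠ w in 𝓝 (z + τ • u), ‖w - z‖ < r :=
      (isOpen_lt (by fun_prop) continuous_const).mem_nhds (by simpa using hτu)
    have ev2 : ∀ᶠ w in 𝓝 (z + τ • u), ‖τ⁻¹ • (w - z)‖ < r :=
      (isOpen_lt (by fun_prop) continuous_const).mem_nhds (by
        show ‖τ⁻¹ • (z + τ • u - z)‖ < r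
        rwa [add_sub_cancel_left, inv_smul_smul₀ hτ.ne'])
    have := adjoint_mem_regularNormalCone (P := C) (C := C) (v := v) hf
      (h u hu τ hτ hτu hv.1) (by
        filter_upwards [ev1, ev2] with w h1 h2 hw
        exact h _ h1 _ (inv_pos.2 hτ) h2 (by simpa using hw)) (by rwa [e])
    -- Pulling back along the dilation by `τ⁻¹` multiplies the normal by `τ⁻¹`; this is undone here.
    have := smul_mem_regularNormalCone hτ this
    rwa [map_smulₛₗ, _root_.smul_apply, ContinuousLinearMap.adjoint_id, smul_smul,
      conj_trivial, mul_inv_cancel₀ hτ.ne', one_smul] at this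
  rintro t s ht hs d v ⟨d', v', hd, hv, hN⟩
  refine ⟨d', v', hd, hv, ?_⟩
  have small : ∀ {t : ℕ → ℝ}, PosTendsToZero t → ∀ᶠ k in atTop, ‖t k • d' k‖ < r := by
    intro t ht
    have := (ht.2.smul hd).norm
    rw [zero_smul, norm_zero] at this
    exact this.eventually_lt_const hr
  filter_upwards [hN, small ht, small hs] with k h1 h2 h3
  have e : s k • d' k = (s k / t k) • t k • d' k := by
    rw [smul_smul, div_mul_cancel₀ _ (ht.1 k).ne']
  rw [e] at h3 ⊢
  exact key _ _ h2 _ (div_pos (hs.1 k) (ht.1 k)) h3 h1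

end VariationalCalculus

/-! ### The complementarity set of a single Lorentz cone -/

noncomputable section LorentzCone

theorem ContDiffAt.toLp_prodMk {X V W : Type*} [NormedAddCommGroup X] [NormedSpace ℝ X]
    [NormedAddCommGroup V] [NormedSpace ℝ V] [NormedAddCommGroup W] [NormedSpace ℝ W]
    {f : X → V} {g : X → W} {x : X} {n : WithTop ℕ∞} (hf : ContDiffAt ℝ n f x)
    (hg : ContDiffAt ℝ n g x) : ContDiffAt ℝ n (fun x => WithLp.toLp 2 (f x, g x)) x :=
  (WithLp.prodContinuousLinearEquiv 2 ℝ V W).symm.contDiff.contDiffAt.comp x (hf.prodMk hg)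

variable {E : Type*} [NormedAddCommGroup E] [InnerProductSpace ℝ E]

theorem contDiff_withLp_fst {n : WithTop ℕ∞} :
    ContDiff ℝ n (fun q : WithLp 2 (E × E) => q.fst) := (WithLp.fstL 2 ℝ E E).contDiff

theorem contDiff_withLp_snd {n : WithTop ℕ∞} :
    ContDiff ℝ n (fun q : WithLp 2 (E × E) => q.snd) := (WithLp.sndL 2 ℝ E E).contDiff

/-- The component of a vector orthogonal to the (unit) vector `e`. -/
def spatialPart (e : E) : E →L[ℝ] E := .id ℝ E - (innerSL ℝ e).smulRight e

/-- The Lorentz cone with axis the unit vector `e`. -/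
def lorentzCone (e : E) : Set E := {x | ‖spatialPart e x‖ ≤ inner ℝ e x}

theorem spatialPart_apply (e x : E) : spatialPart e x = x - (inner ℝ e x : ℝ) • e := by
  simp [spatialPart]

variable {e : E}

theorem inner_spatialPart (he : ‖e‖ = 1) (x : E) : inner ℝ e (spatialPart e x) = 0 := by
  simp [spatialPart_apply, inner_sub_right, inner_smul_right, he]

theorem spatialPart_self (he : ‖e‖ = 1) : spatialPart e e = 0 := by
  simp [spatialPart_apply, he]

theorem spatialPart_spatialPart (he : ‖e‖ = 1) (x : E) :
    spatialPart e (spatialPart e x) = spatialPart e x := by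
  rw [spatialPart_apply e (spatialPart e x), inner_spatialPart he, zero_smul, sub_zero]

theorem inner_eq_mul_add_inner_spatialPart (he : ‖e‖ = 1) (x y : E) :
    inner ℝ x y = inner ℝ e x * inner ℝ e y + inner ℝ (spatialPart e x) (spatialPart e y) := by
  simp only [spatialPart_apply, inner_sub_left, inner_sub_right, real_inner_smul_left,
    real_inner_smul_right, real_inner_self_eq_norm_sq, he, real_inner_comm x e]
  ring

theorem neg_mul_le_inner_spatialPart {y : E} (hy : y ∈ lorentzCone e) (x : E) :
    -(‖spatialPart e x‖ * inner ℝ e y) ≤ inner ℝ (spatialPart e x) (spatialPart e y) := by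
  have h1 := neg_le_of_abs_le (abs_real_inner_le_norm (spatialPart e x) (spatialPart e y))
  have h2 := mul_le_mul_of_nonneg_left hy.out (norm_nonneg (spatialPart e x))
  linarith

theorem inner_axis_nonneg {x : E} (hx : x ∈ lorentzCone e) : 0 ≤ inner ℝ e x :=
  (norm_nonneg _).trans hx

theorem inner_nonneg_of_mem_lorentzCone (he : ‖e‖ = 1) {x y : E} (hx : x ∈ lorentzCone e)
    (hy : y ∈ lorentzCone e) : 0 ≤ inner ℝ x y := by
  rw [inner_eq_mul_add_inner_spatialPart he]
  have h1 := neg_mul_le_inner_spatialPart hy x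
  have h2 := mul_le_mul_of_nonneg_right hx.out (inner_axis_nonneg hy)
  linarith

theorem eq_zero_of_inner_axis_eq_zero {x : E} (hx : x ∈ lorentzCone e) (h : inner ℝ e x = 0) :
    x = 0 := by
  have h1 : spatialPart e x = 0 := norm_le_zero_iff.1 (hx.out.trans h.le)
  simpa [spatialPart_apply, h] using h1

/-- The complementarity relation forces `y = 0` when `x` is interior to the cone. -/
theorem eq_zero_of_mem_interior (he : ‖e‖ = 1) {x y : E} (hx : ‖spatialPart e x‖ < inner ℝ e x)
    (hy : y ∈ lorentzCone e) (h : inner ℝ x y = 0) : y = 0 := by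
  refine eq_zero_of_inner_axis_eq_zero hy (le_antisymm ?_ (inner_axis_nonneg hy))
  rw [inner_eq_mul_add_inner_spatialPart he] at h
  have h1 := neg_mul_le_inner_spatialPart hy x
  by_contra! hpos
  nlinarith [mul_pos (sub_pos.2 hx) hpos]

theorem smul_mem_lorentzCone {x : E} (hx : x ∈ lorentzCone e) {τ : ℝ} (hτ : 0 < τ) :
    τ • x ∈ lorentzCone e := by
  show ‖spatialPart e (τ • x)‖ ≤ inner ℝ e (τ • x)
  rw [map_smul, norm_smul, Real.norm_of_nonneg hτ.le, real_inner_smul_right]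
  exact mul_le_mul_of_nonneg_left hx hτ.le

theorem isClosed_lorentzCone : IsClosed (lorentzCone e) :=
  isClosed_le (by fun_prop) (by fun_prop)

/-- For `σ = 1`, the shear straightening the complementarity set of the Lorentz cone near points
whose first component is off the axis; for `σ = -1`, its inverse. -/
def lorentzShear (e : E) (σ : ℝ) (q : WithLp 2 (E × E)) : WithLp 2 (E × E) :=
  WithLp.toLp 2 (q.fst - (σ * ‖spatialPart e q.fst‖) • e,
    q.snd + (σ * (inner ℝ e q.snd / ‖spatialPart e q.fst‖)) • spatialPart e q.fst)

/-- The straightened complementarity set. -/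
def straightComplementaritySet (e : E) : Set (WithLp 2 (E × E)) :=
  {w | 0 ≤ inner ℝ e w.fst ∧ 0 ≤ inner ℝ e w.snd ∧ inner ℝ e w.fst * inner ℝ e w.snd = 0 ∧
    spatialPart e w.snd = 0}

theorem contDiffAt_lorentzShear (e : E) (σ : ℝ) {q : WithLp 2 (E × E)}
    (hq : spatialPart e q.fst ≠ 0) : ContDiffAt ℝ 1 (lorentzShear e σ) q := by
  have h1 : ContDiffAt ℝ 1 (fun q : WithLp 2 (E × E) => q.fst) q := contDiff_withLp_fst.contDiffAt
  have h2 : ContDiffAt ℝ 1 (fun q : WithLp 2 (E × E) => q.snd) q := contDiff_withLp_snd.contDiffAt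
  have h3 : ContDiffAt ℝ 1 (fun q : WithLp 2 (E × E) => spatialPart e q.fst) q :=
    (spatialPart e).contDiff.contDiffAt.comp q h1
  have h4 := h3.norm ℝ hq
  have h5 : ContDiffAt ℝ 1 (fun q : WithLp 2 (E × E) => inner ℝ e q.snd) q :=
    contDiffAt_const.inner ℝ h2
  exact (h1.sub ((contDiffAt_const.mul h4).smul contDiffAt_const)).toLp_prodMk
    (h2.add ((contDiffAt_const.mul (h5.div h4 (norm_ne_zero_iff.2 hq))).smul h3))

theorem spatialPart_lorentzShear_fst (he : ‖e‖ = 1) (σ : ℝ) (q : WithLp 2 (E × E)) :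
    spatialPart e (lorentzShear e σ q).fst = spatialPart e q.fst := by
  simp [lorentzShear, spatialPart_self he]

theorem inner_lorentzShear_fst (he : ‖e‖ = 1) (σ : ℝ) (q : WithLp 2 (E × E)) :
    inner ℝ e (lorentzShear e σ q).fst = inner ℝ e q.fst - σ * ‖spatialPart e q.fst‖ := by
  simp [lorentzShear, inner_sub_right, real_inner_smul_right, he]

theorem inner_lorentzShear_snd (he : ‖e‖ = 1) (σ : ℝ) (q : WithLp 2 (E × E)) :
    inner ℝ e (lorentzShear e σ q).snd = inner ℝ e q.snd := by
  simp [lorentzShear, inner_add_right, real_inner_smul_right, inner_spatialPart he]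

theorem spatialPart_lorentzShear_snd (he : ‖e‖ = 1) (σ : ℝ) (q : WithLp 2 (E × E)) :
    spatialPart e (lorentzShear e σ q).snd = spatialPart e q.snd +
      (σ * (inner ℝ e q.snd / ‖spatialPart e q.fst‖)) • spatialPart e q.fst := by
  simp [lorentzShear, spatialPart_spatialPart he]

theorem lorentzShear_lorentzShear (he : ‖e‖ = 1) {σ τ : ℝ} (h : σ + τ = 0)
    (q : WithLp 2 (E × E)) : lorentzShear e σ (lorentzShear e τ q) = q := by
  obtain rfl : σ = -τ := by linarith
  rw [lorentzShear, spatialPart_lorentzShear_fst he, inner_lorentzShear_snd he]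
  simp [lorentzShear]
  rfl

/-- Orthogonality makes Cauchy–Schwarz tight: (x₀ - ‖x̄‖)y₀ = 0 and ⟪x̄, ȳ⟫ = -‖x̄‖y₀. Expanding the
square gives ‖ȳ + (y₀/‖x̄‖)x̄‖² = ‖ȳ‖² - y₀² ≤ 0, so ȳ is the multiple of x̄ removed by the shear.
-/
theorem lorentzShear_mem (he : ‖e‖ = 1) {q : WithLp 2 (E × E)} (hq : spatialPart e q.fst ≠ 0)
    (h : q ∈ ComplementaritySet (lorentzCone e)) :
    lorentzShear e 1 q ∈ straightComplementaritySet e := by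
  obtain ⟨hx, hy, hxy⟩ := h
  have hx' := hx.out
  have hy' := hy.out
  have hy0 := inner_axis_nonneg hy
  have hlow := neg_mul_le_inner_spatialPart hy q.fst
  have hn : 0 < ‖spatialPart e q.fst‖ := norm_pos_iff.2 hq
  rw [inner_eq_mul_add_inner_spatialPart he] at hxy
  have hcomp : (inner ℝ e q.fst - ‖spatialPart e q.fst‖) * inner ℝ e q.snd = 0 :=
    le_antisymm (by linarith) (mul_nonneg (sub_nonneg.2 hx') hy0)
  refine ⟨?_, ?_, ?_, ?_⟩
  · rw [inner_lorentzShear_fst he]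
    linarith
  · rwa [inner_lorentzShear_snd he]
  · rw [inner_lorentzShear_fst he, inner_lorentzShear_snd he, one_mul, hcomp]
  · rw [spatialPart_lorentzShear_snd he, one_mul]
    refine norm_eq_zero.1 (pow_eq_zero_iff two_ne_zero |>.1 (le_antisymm ?_ (sq_nonneg _)))
    rw [norm_add_sq_real, real_inner_smul_right, norm_smul, norm_div, norm_norm,
      Real.norm_of_nonneg hy0, div_mul_cancel₀ _ hn.ne',
      real_inner_comm (spatialPart e q.fst)]
    have h1 : inner ℝ (spatialPart e q.fst) (spatialPart e q.snd) =
        -(‖spatialPart e q.fst‖ * inner ℝ e q.snd) := by linarith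
    have h2 : inner ℝ e q.snd / ‖spatialPart e q.fst‖ *
        (-(‖spatialPart e q.fst‖ * inner ℝ e q.snd)) = -(inner ℝ e q.snd) ^ 2 := by
      field_simp
    rw [h1, h2]
    have h3 := pow_le_pow_left₀ (norm_nonneg _) hy' 2
    linarith

theorem lorentzShear_neg_mem (he : ‖e‖ = 1) {w : WithLp 2 (E × E)}
    (hw : spatialPart e w.fst ≠ 0) (h : w ∈ straightComplementaritySet e) :
    lorentzShear e (-1) w ∈ ComplementaritySet (lorentzCone e) := by
  obtain ⟨h1, h2, h3, h4⟩ := h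
  have hn : 0 < ‖spatialPart e w.fst‖ := norm_pos_iff.2 hw
  refine ⟨?_, ?_, ?_⟩
  · show ‖spatialPart e _‖ ≤ inner ℝ e _
    rw [spatialPart_lorentzShear_fst he, inner_lorentzShear_fst he]
    linarith
  · show ‖spatialPart e _‖ ≤ inner ℝ e _
    rw [spatialPart_lorentzShear_snd he, inner_lorentzShear_snd he, h4, zero_add, norm_smul,
      norm_mul, norm_div, norm_norm, Real.norm_of_nonneg h2, norm_neg, norm_one, one_mul,
      div_mul_cancel₀ _ hn.ne']
  · rw [inner_eq_mul_add_inner_spatialPart he, spatialPart_lorentzShear_fst he,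
      inner_lorentzShear_fst he, spatialPart_lorentzShear_snd he, inner_lorentzShear_snd he, h4,
      zero_add, real_inner_smul_right, real_inner_self_eq_norm_sq]
    field_simp
    linarith

theorem abs_inner_axis_fst_le (he : ‖e‖ = 1) (u : WithLp 2 (E × E)) :
    |inner ℝ e u.fst| ≤ ‖u‖ :=
  (abs_real_inner_le_norm _ _).trans (by rw [he, one_mul]; exact WithLp.norm_fst_le _ u)

theorem abs_inner_axis_snd_le (he : ‖e‖ = 1) (u : WithLp 2 (E × E)) :
    |inner ℝ e u.snd| ≤ ‖u‖ :=
  (abs_real_inner_le_norm _ _).trans (by rw [he, one_mul]; exact WithLp.norm_snd_le _ u)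

/-- If one axis coordinate of `w` is positive, it serves as the radius: smaller perturbations keep
it positive, so the other coordinate must remain zero. If both vanish, the conditions on the
perturbation are homogeneous and any radius works. -/
theorem locallyConicAt_straightComplementaritySet (he : ‖e‖ = 1) {w : WithLp 2 (E × E)}
    (hw : w ∈ straightComplementaritySet e) :
    LocallyConicAt (straightComplementaritySet e) w := by
  obtain ⟨h1, h2, h3, h4⟩ := hw
  have mem : ∀ v : WithLp 2 (E × E), w + v ∈ straightComplementaritySet e ↔
      0 ≤ inner ℝ e w.fst + inner ℝ e v.fst ∧ 0 ≤ inner ℝ e w.snd + inner ℝ e v.snd ∧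
      (inner ℝ e w.fst + inner ℝ e v.fst) * (inner ℝ e w.snd + inner ℝ e v.snd) = 0 ∧
      spatialPart e v.snd = 0 := by
    intro v
    simp [straightComplementaritySet, inner_add_right, h4]
  simp only [LocallyConicAt, mem, WithLp.smul_fst, WithLp.smul_snd, real_inner_smul_right, map_smul]
  rcases h1.eq_or_lt with h1 | h1
  · rcases h2.eq_or_lt with h2 | h2
    · refine ⟨1, one_pos, fun u _ τ hτ _ ⟨k1, k2, k3, k4⟩ => ?_⟩
      rw [← h1, zero_add] at k1 k3 ⊢
      rw [← h2, zero_add] at k2 k3 ⊢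
      refine ⟨by positivity, by positivity, ?_, by rw [k4, smul_zero]⟩
      linear_combination τ ^ 2 * k3
    · refine ⟨_, h2, fun u hu τ hτ hτu ⟨k1, k2, k3, k4⟩ => ?_⟩
      have a1 := neg_le_of_abs_le (abs_inner_axis_snd_le he u)
      have a2 := neg_le_of_abs_le (abs_inner_axis_snd_le he (τ • u))
      rw [WithLp.smul_snd, real_inner_smul_right] at a2
      have k5 := (mul_eq_zero.1 k3).resolve_right (by linarith)
      rw [← h1, zero_add] at k5 ⊢
      rw [k5]
      exact ⟨by simp, by linarith, by simp, by rw [k4, smul_zero]⟩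
  · have h2 := (mul_eq_zero.1 h3).resolve_left h1.ne'
    refine ⟨_, h1, fun u hu τ hτ hτu ⟨k1, k2, k3, k4⟩ => ?_⟩
    have a1 := neg_le_of_abs_le (abs_inner_axis_fst_le he u)
    have a2 := neg_le_of_abs_le (abs_inner_axis_fst_le he (τ • u))
    rw [WithLp.smul_fst, real_inner_smul_right] at a2
    have k5 := (mul_eq_zero.1 k3).resolve_left (by linarith)
    rw [h2, zero_add] at k5 ⊢
    rw [k5]
    exact ⟨by linarith, by simp, by simp, by rw [k4, smul_zero]⟩

theorem directionallyRegularAt_of_spatialPart_ne_zero [CompleteSpace E] (he : ‖e‖ = 1)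
    {q : WithLp 2 (E × E)} (h : q ∈ ComplementaritySet (lorentzCone e))
    (hq : spatialPart e q.fst ≠ 0) :
    DirectionallyRegularAt (ComplementaritySet (lorentzCone e)) q := by
  have hq' : spatialPart e (lorentzShear e 1 q).fst ≠ 0 := by
    rwa [spatialPart_lorentzShear_fst he]
  have ev : ∀ {q : WithLp 2 (E × E)}, spatialPart e q.fst ≠ 0 →
      ∀ᶠ u in 𝓝 q, spatialPart e (WithLp.fst u) ≠ 0 := fun {q} hq =>
    ((spatialPart e).continuous.comp
      (contDiff_withLp_fst (n := 0)).continuous).continuousAt.eventually_ne hq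
  refine DirectionallyRegularAt.of_chart (Φ := lorentzShear e 1) (Ψ := lorentzShear e (-1))
    (contDiffAt_lorentzShear e 1 hq) (contDiffAt_lorentzShear e (-1) hq')
    (Eventually.of_forall (lorentzShear_lorentzShear he (by norm_num)))
    (Eventually.of_forall (lorentzShear_lorentzShear he (by norm_num)))
    ((ev hq).mono fun u hu => lorentzShear_mem he hu)
    ((ev hq').mono fun u hu => lorentzShear_neg_mem he hu)
    (locallyConicAt_straightComplementaritySet he (lorentzShear_mem he hq h)).directionallyRegularAt

/-- Here the first component lies in the open cone and continues to do so nearby, which forces the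
second to vanish: locally the set is the subspace E × {0}. -/
theorem locallyConicAt_of_spatialPart_eq_zero (he : ‖e‖ = 1) {q : WithLp 2 (E × E)}
    (h : q ∈ ComplementaritySet (lorentzCone e)) (hq : spatialPart e q.fst = 0)
    (hx : q.fst ≠ 0) : LocallyConicAt (ComplementaritySet (lorentzCone e)) q := by
  have hpos : 0 < inner ℝ e q.fst := (inner_axis_nonneg h.1).lt_of_ne fun h0 =>
    hx (eq_zero_of_inner_axis_eq_zero h.1 h0.symm)
  have hcont : ∀ᶠ u in 𝓝 (0 : WithLp 2 (E × E)),
      ‖spatialPart e (q + u).fst‖ < inner ℝ e (q + u).fst := by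
    refine ContinuousAt.eventually_lt (f := fun u : WithLp 2 (E × E) => ‖spatialPart e (q + u).fst‖)
      (g := fun u : WithLp 2 (E × E) => (inner ℝ e (q + u).fst : ℝ)) ?_ ?_ (by simpa [hq] using hpos)
    · have := (contDiff_withLp_fst (E := E) (n := 0)).continuous
      fun_prop
    · have := (contDiff_withLp_fst (E := E) (n := 0)).continuous
      fun_prop
  have hy := eq_zero_of_mem_interior he (by rwa [hq, norm_zero]) h.2.1 h.2.2
  obtain ⟨r, hr, hball⟩ := Metric.eventually_nhds_iff.1 hcont
  simp only [dist_zero_right] at hball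
  refine ⟨r, hr, fun u hu τ hτ hτu hmem => ?_⟩
  have h0 := eq_zero_of_mem_interior he (hball hu) hmem.2.1 hmem.2.2
  rw [WithLp.add_snd, hy, zero_add] at h0
  have h1 : (q + τ • u).snd = 0 := by simp [hy, h0]
  refine ⟨(hball hτu).le, ?_, ?_⟩
  · simp [h1, lorentzCone]
  · simp [h1]

theorem swap_mem_complementaritySet {K : Set E} {q : WithLp 2 (E × E)}
    (h : q ∈ ComplementaritySet K) : WithLp.toLp 2 (q.snd, q.fst) ∈ ComplementaritySet K :=
  ⟨h.2.1, h.1, by rw [real_inner_comm]; exact h.2.2⟩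

theorem DirectionallyRegularAt.of_swap [CompleteSpace E] {K : Set E} {q : WithLp 2 (E × E)}
    (h : DirectionallyRegularAt (ComplementaritySet K) (WithLp.toLp 2 (q.snd, q.fst))) :
    DirectionallyRegularAt (ComplementaritySet K) q := by
  have hc : ∀ q : WithLp 2 (E × E),
      ContDiffAt ℝ 1 (fun q : WithLp 2 (E × E) => WithLp.toLp 2 (q.snd, q.fst)) q :=
    fun q => contDiff_withLp_snd.contDiffAt.toLp_prodMk contDiff_withLp_fst.contDiffAt
  exact DirectionallyRegularAt.of_chart
    (Φ := fun q : WithLp 2 (E × E) => WithLp.toLp 2 (q.snd, q.fst))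
    (Ψ := fun q : WithLp 2 (E × E) => WithLp.toLp 2 (q.snd, q.fst)) (hc _) (hc _)
    (Eventually.of_forall fun _ => rfl) (Eventually.of_forall fun _ => rfl)
    (Eventually.of_forall fun _ => swap_mem_complementaritySet)
    (Eventually.of_forall fun _ => swap_mem_complementaritySet) h

/-- The complementarity set of a Lorentz cone is directionally regular. -/
theorem directionallyRegularAt_complementaritySet_lorentzCone [CompleteSpace E] (he : ‖e‖ = 1)
    {q : WithLp 2 (E × E)} (h : q ∈ ComplementaritySet (lorentzCone e)) :
    DirectionallyRegularAt (ComplementaritySet (lorentzCone e)) q := by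
  have key : ∀ q ∈ ComplementaritySet (lorentzCone e), q.fst ≠ 0 →
      DirectionallyRegularAt (ComplementaritySet (lorentzCone e)) q := by
    intro q h hx
    by_cases hq : spatialPart e q.fst = 0
    · exact (locallyConicAt_of_spatialPart_eq_zero he h hq hx).directionallyRegularAt
    · exact directionallyRegularAt_of_spatialPart_ne_zero he h hq
  by_cases hx : q.fst = 0
  · by_cases hy : q.snd = 0
    · refine LocallyConicAt.directionallyRegularAt ⟨1, one_pos, fun u _ τ hτ _ hu => ?_⟩
      simp only [ComplementaritySet, Set.mem_ofPred_eq, WithLp.add_fst, WithLp.add_snd, hx, hy,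
        zero_add, WithLp.smul_fst, WithLp.smul_snd] at hu ⊢
      refine ⟨smul_mem_lorentzCone hu.1 hτ, smul_mem_lorentzCone hu.2.1 hτ, ?_⟩
      rw [real_inner_smul_left, real_inner_smul_right, hu.2.2, mul_zero, mul_zero]
    · exact (key _ (swap_mem_complementaritySet h) hy).of_swap
  · exact key q h hx

end LorentzCone

/-! ### Error bound from the first-order condition -/

section ErrorBound

variable {X Y : Type*} [NormedAddCommGroup X] [InnerProductSpace ℝ X] [FiniteDimensional ℝ X]
  [NormedAddCommGroup Y] [InnerProductSpace ℝ Y] [FiniteDimensional ℝ Y]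

/-- The residual at a nearest point is a regular normal. -/
theorem sub_mem_regularNormalCone {V : Type*} [NormedAddCommGroup V] [InnerProductSpace ℝ V]
    {D : Set V} {a y : V} (hy : y ∈ D) (h : ∀ y' ∈ D, ‖a - y‖ ≤ ‖a - y'‖) :
    a - y ∈ RegularNormalCone D y := by
  refine ⟨hy, fun ε hε => ?_⟩
  filter_upwards [nhdsWithin_le_nhds (Metric.ball_mem_nhds y hε), self_mem_nhdsWithin] with y' h1 h2
  rw [Metric.mem_ball, dist_eq_norm] at h1
  have h3 := pow_le_pow_left₀ (norm_nonneg _) (h y' h2) 2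
  -- Squaring the nearest-point inequality yields ⟪a - y, y' - y⟫ ≤ ‖y' - y‖²/2.
  rw [show a - y' = (a - y) - (y' - y) by abel, norm_sub_sq_real (a - y)] at h3
  have h4 := mul_le_mul_of_nonneg_right h1.le (norm_nonneg (y' - y))
  nlinarith [norm_nonneg (y' - y)]

/-- If `x ↦ ‖g x - y‖` does not decrease from `z` faster than with rate `C`, then the gradient
of this function has norm at most `C`. -/
theorem norm_adjoint_fderiv_le {g : X → Y} {z : X} {y : Y} {C : ℝ} (hC : 0 ≤ C)
    (hg : DifferentiableAt ℝ g z)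
    (hy : g z ≠ y) (h : ∀ x, ‖g z - y‖ - C * ‖x - z‖ ≤ ‖g x - y‖) :
    ‖(fderiv ℝ g z).adjoint (‖g z - y‖⁻¹ • (g z - y))‖ ≤ C := by
  set v := ‖g z - y‖⁻¹ • (g z - y) with hv
  have hne : ‖g z - y‖ ≠ 0 := norm_ne_zero_iff.2 (sub_ne_zero.2 hy)
  have key : ∀ u : X, -(C * ‖u‖) ≤ inner ℝ v (fderiv ℝ g z u) := by
    intro u
    have hline : HasDerivAt (fun τ : ℝ => z + τ • u) u 0 := by
      simpa using ((hasDerivAt_id (0 : ℝ)).smul_const u).const_add z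
    have hgl : HasDerivAt (fun τ : ℝ => g (z + τ • u) - y) (fderiv ℝ g z u) 0 := by
      refine HasDerivAt.sub_const y ?_
      exact HasFDerivAt.comp_hasDerivAt_of_eq (0 : ℝ) hg.hasFDerivAt hline (by simp)
    have hsq := hgl.norm_sq.sqrt (by simpa using hne)
    simp only [Real.sqrt_sq (norm_nonneg _), zero_smul, add_zero] at hsq
    have hder : HasDerivAt (fun τ : ℝ => ‖g (z + τ • u) - y‖) (inner ℝ v (fderiv ℝ g z u)) 0 := by
      convert hsq using 1
      rw [hv, real_inner_smul_left]
      field_simp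
    have hs := (hasDerivAt_iff_tendsto_slope.1 hder).mono_left
      (nhdsWithin_mono (0 : ℝ) (s := Set.Ioi 0) fun x hx => ne_of_gt hx)
    refine ge_of_tendsto hs ?_
    filter_upwards [self_mem_nhdsWithin] with τ hτ
    have hτ : 0 < τ := hτ
    have h1 := h (z + τ • u)
    rw [add_sub_cancel_left, norm_smul, Real.norm_of_nonneg hτ.le] at h1
    rw [slope_def_field, sub_zero, zero_smul, add_zero, le_div_iff₀ hτ]
    linarith
  set a := (fderiv ℝ g z).adjoint v
  -- Steepest descent: the choice `u = -a` gives ‖a‖² ≤ C‖a‖.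
  have h1 := key (-a)
  rw [norm_neg, map_neg, inner_neg_right, ← ContinuousLinearMap.adjoint_inner_left,
    real_inner_self_eq_norm_sq] at h1
  rcases (norm_nonneg a).eq_or_lt with h0 | h0
  · rwa [← h0]
  · exact le_of_mul_le_mul_right (by linarith) h0

/-- An approximate critical point for the distance to `D`, near a point violating an error
bound with constant `c`. -/
theorem exists_almost_critical_point {g : X → Y} {D : Set Y} (hg : Differentiable ℝ g)
    (hD : IsClosed D) (hne : D.Nonempty) {z : X} {c : ℝ} (hc : 0 < c)
    (h : c * Metric.infDist (g z) D < Metric.infDist z (g ⁻¹' D)) :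
    ∃ (x : X) (y v : Y), v ∈ RegularNormalCone D y ∧ ‖v‖ = 1 ∧
      ‖(fderiv ℝ g x).adjoint v‖ ≤ 2 / c ∧ ‖y - g x‖ ≤ Metric.infDist (g z) D ∧
      ‖x - z‖ ≤ Metric.infDist z (g ⁻¹' D) / 2 := by
  set R := Metric.infDist z (g ⁻¹' D)
  -- With weight 2/c, a minimizer satisfies (2/c) dist x z ≤ infDist (g z) D < R/c. Hence it lies
  -- within R/2 of `z` and cannot be a solution. Coercivity of the penalty provides the minimizer.
  set θ : X → ℝ := fun x => Metric.infDist (g x) D + 2 / c * dist x z with hθ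
  have hθc : Continuous θ := by
    have := hg.continuous
    have := Metric.continuous_infDist_pt D
    fun_prop
  have hθz : θ z = Metric.infDist (g z) D := by simp [hθ]
  have h0 : 0 ≤ Metric.infDist (g z) D := Metric.infDist_nonneg
  obtain ⟨x, hx⟩ := hθc.exists_forall_le' z (by
    filter_upwards [(tendsto_dist_right_cocompact_atTop z).eventually_ge_atTop (c / 2 * θ z)]
      with x hx
    have h1 : 2 / c * (c / 2 * θ z) ≤ 2 / c * dist x z := by gcongr
    have h2 : 2 / c * (c / 2 * θ z) = θ z := by field_simp
    have h3 : 0 ≤ Metric.infDist (g x) D := Metric.infDist_nonneg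
    simp only [hθ] at h1 h2 ⊢
    linarith)
  have hxz := hx z
  rw [hθz] at hxz
  have hx1 : Metric.infDist (g x) D + 2 / c * dist x z ≤ Metric.infDist (g z) D := hxz
  have hgx0 : 0 ≤ Metric.infDist (g x) D := Metric.infDist_nonneg
  have hR : c * (2 / c * dist x z) < R := by
    refine lt_of_le_of_lt ?_ h
    gcongr
    linarith
  rw [← mul_assoc, mul_div_cancel₀ _ hc.ne'] at hR
  have hxS : g x ∉ D := fun hmem => by
    have h1 : R ≤ dist z x := Metric.infDist_le_dist_of_mem hmem
    rw [dist_comm] at h1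
    linarith [dist_nonneg (x := x) (y := z)]
  obtain ⟨y, hy, hxy⟩ := hD.exists_infDist_eq_dist hne (g x)
  have hyne : g x ≠ y := fun h => hxS (h ▸ hy)
  have hpos : 0 < ‖g x - y‖ := norm_pos_iff.2 (sub_ne_zero.2 hyne)
  rw [dist_eq_norm] at hxy
  have hnear : ∀ y' ∈ D, ‖g x - y‖ ≤ ‖g x - y'‖ := fun y' hy' => by
    rw [← hxy, ← dist_eq_norm]
    exact Metric.infDist_le_dist_of_mem hy'
  refine ⟨x, y, ‖g x - y‖⁻¹ • (g x - y),
    smul_mem_regularNormalCone (inv_pos.2 hpos) (sub_mem_regularNormalCone hy hnear), ?_, ?_, ?_, ?_⟩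
  · rw [norm_smul, norm_inv, norm_norm, inv_mul_cancel₀ hpos.ne']
  · refine norm_adjoint_fderiv_le (by positivity) (hg x) hyne fun x' => ?_
    have h1 : Metric.infDist (g x) D + 2 / c * dist x z ≤
      Metric.infDist (g x') D + 2 / c * dist x' z := hx x'
    have h2 : Metric.infDist (g x') D ≤ ‖g x' - y‖ := by
      rw [← dist_eq_norm]
      exact Metric.infDist_le_dist_of_mem hy
    have h3 : 2 / c * dist x' z ≤ 2 / c * (‖x' - x‖ + dist x z) := by
      gcongr
      rw [← dist_eq_norm]
      exact dist_triangle _ _ _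
    linarith
  · rw [norm_sub_rev, ← hxy]
    have : 0 ≤ 2 / c * dist x z := by positivity
    linarith
  · rw [← dist_eq_norm]
    linarith

/-- The first-order sufficient condition for metric subregularity, as an error bound. -/
theorem exists_errorBound_of_firstOrderCondition {g : X → Y} {D : Set Y} (hg : ContDiff ℝ 1 g)
    (hD : IsClosed D) {zs : X} (hzs : g zs ∈ D)
    (H : ∀ w : X, w ≠ 0 → fderiv ℝ g zs w ∈ TangentCone D (g zs) →
      ∀ v ∈ DirectionalNormalCone D (g zs) (fderiv ℝ g zs w),
        (fderiv ℝ g zs).adjoint v = 0 → v = 0) :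
    ∃ κ : ℝ, 0 < κ ∧ ∃ U ∈ 𝓝 zs, ∀ z ∈ U,
      Metric.infDist z (g ⁻¹' D) ≤ κ * Metric.infDist (g z) D := by
  by_contra! hcon
  have hgd : Differentiable ℝ g := hg.differentiable one_ne_zero
  have hbad : ∀ k : ℕ, ∃ z ∈ Metric.ball zs (1 / ((k : ℝ) + 1)),
      ((k : ℝ) + 1) * Metric.infDist (g z) D < Metric.infDist z (g ⁻¹' D) := fun k =>
    hcon _ (by positivity) _ (Metric.ball_mem_nhds zs (by positivity))
  choose z hz hzk using hbad
  choose x y v hv hv1 hadj hy hx using fun k =>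
    exists_almost_critical_point hgd hD ⟨_, hzs⟩ (by positivity) (hzk k)
  have hzd : ∀ k, Metric.infDist (z k) (g ⁻¹' D) ≤ ‖z k - zs‖ := fun k => by
    rw [← dist_eq_norm]
    exact Metric.infDist_le_dist_of_mem hzs
  have hz0 : ∀ k, 0 < ‖z k - zs‖ := fun k => by
    refine lt_of_lt_of_le (lt_of_le_of_lt ?_ (hzk k)) (hzd k)
    have : 0 ≤ Metric.infDist (g (z k)) D := Metric.infDist_nonneg
    positivity
  -- Moving from `z k` to `x k` covers at most half the distance to `zs`, so ‖x k - zs‖ stays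
  -- positive and can serve as the step size.
  have hr1 : ∀ k, ‖z k - zs‖ ≤ 2 * ‖x k - zs‖ := fun k => by
    have h1 := norm_sub_le_norm_sub_add_norm_sub (z k) (x k) zs
    rw [norm_sub_rev (z k) (x k)] at h1
    linarith [hx k, hzd k]
  have hr2 : ∀ k, ‖x k - zs‖ ≤ 2 * (1 / ((k : ℝ) + 1)) := fun k => by
    have h1 := norm_sub_le_norm_sub_add_norm_sub (x k) (z k) zs
    have h2 := hz k
    rw [Metric.mem_ball, dist_eq_norm] at h2
    linarith [hx k, hzd k, hz0 k]
  have hr : PosTendsToZero fun k => ‖x k - zs‖ :=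
    ⟨fun k => by linarith [hz0 k, hr1 k], squeeze_zero (fun _ => norm_nonneg _) hr2
      (by simpa using posTendsToZero_one_div.2.const_mul 2)⟩
  -- The projection moves `g (x k)` by o(‖x k - zs‖), so `y k` approaches `g zs` in the same
  -- direction as `g (x k)`.
  have hyk : ∀ k, ‖y k - g (x k)‖ ≤ ‖x k - zs‖ * (2 * (1 / ((k : ℝ) + 1))) := fun k => by
    have hk : (0 : ℝ) < (k : ℝ) + 1 := by positivity
    have h1 : ((k : ℝ) + 1) * ‖y k - g (x k)‖ ≤ 2 * ‖x k - zs‖ :=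
      (mul_le_mul_of_nonneg_left (hy k) hk.le).trans
        ((hzk k).le.trans ((hzd k).trans (hr1 k)))
    rw [← le_div_iff₀' hk] at h1
    refine h1.trans (le_of_eq ?_)
    ring
  obtain ⟨⟨w, v₀⟩, hmem, φ, hφ, hlim⟩ :=
    ((isCompact_sphere (0 : X) 1).prod (isCompact_sphere (0 : Y) 1)).tendsto_subseq
      (x := fun k => (‖x k - zs‖⁻¹ • (x k - zs), v k)) (fun k => by
        refine ⟨?_, ?_⟩
        · rw [mem_sphere_zero_iff_norm, norm_smul, norm_inv, norm_norm,
            inv_mul_cancel₀ (hr.1 k).ne']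
        · rw [mem_sphere_zero_iff_norm, hv1 k])
  have hw1 : ‖w‖ = 1 := mem_sphere_zero_iff_norm.1 hmem.1
  have hv01 : ‖v₀‖ = 1 := mem_sphere_zero_iff_norm.1 hmem.2
  have hwlim : Tendsto (fun k => ‖x (φ k) - zs‖⁻¹ • (x (φ k) - zs)) atTop (𝓝 w) :=
    (continuous_fst.tendsto _).comp hlim
  have hvlim : Tendsto (fun k => v (φ k)) atTop (𝓝 v₀) := (continuous_snd.tendsto _).comp hlim
  have ht := hr.comp hφ
  have hinv := posTendsToZero_one_div.2.comp hφ.tendsto_atTop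
  have hxe : ∀ k, zs + ‖x k - zs‖ • ‖x k - zs‖⁻¹ • (x k - zs) = x k := fun k => by
    rw [smul_inv_smul₀ (hr.1 k).ne', add_sub_cancel]
  have hxlim : Tendsto (fun k => x (φ k)) atTop (𝓝 zs) := by
    refine (ht.tendsto_add_smul hwlim).congr fun k => hxe (φ k)
  have hd1 := ht.tendsto_difference_quotient (hgd zs).hasFDerivAt hwlim
  have hd2 : Tendsto (fun k => ‖x (φ k) - zs‖⁻¹ • (y (φ k) - g (x (φ k)))) atTop (𝓝 0) := by
    refine squeeze_zero_norm (a := fun k => 2 * (1 / ((φ k : ℝ) + 1))) (fun k => ?_)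
      (by simpa using! hinv.const_mul 2)
    rw [norm_smul, norm_inv, norm_norm, inv_mul_le_iff₀ (hr.1 _)]
    exact hyk (φ k)
  have hd : Tendsto (fun k => ‖x (φ k) - zs‖⁻¹ • (y (φ k) - g zs)) atTop
      (𝓝 (fderiv ℝ g zs w)) := by
    have := hd1.add hd2
    rw [add_zero] at this
    refine this.congr fun k => ?_
    simp only [Function.comp, hxe]
    rw [← smul_add]
    congr 1
    abel
  have hN : v₀ ∈ DirectionalNormalCone D (g zs) (fderiv ℝ g zs w) := by
    refine ⟨_, _, _, ht, hd, hvlim, fun k => ?_⟩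
    simp only [Function.comp]
    rw [smul_inv_smul₀ (hr.1 _).ne', add_sub_cancel]
    exact hv (φ k)
  have hA : Tendsto (fun k => (fderiv ℝ g (x (φ k))).adjoint (v (φ k))) atTop
      (𝓝 ((fderiv ℝ g zs).adjoint v₀)) := by
    have h1 : Tendsto (fun k => (fderiv ℝ g (x (φ k))).adjoint) atTop
        (𝓝 (fderiv ℝ g zs).adjoint) :=
      (ContinuousLinearMap.adjoint.continuous.tendsto _).comp
        (((hg.continuous_fderiv one_ne_zero).tendsto _).comp hxlim)
    exact tendsto_clm_apply h1 hvlim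
  have hA0 : Tendsto (fun k => (fderiv ℝ g (x (φ k))).adjoint (v (φ k))) atTop (𝓝 0) := by
    refine squeeze_zero_norm (a := fun k => 2 * (1 / ((φ k : ℝ) + 1)))
      (fun k => (hadj (φ k)).trans_eq ?_) (by simpa using! hinv.const_mul 2)
    ring
  have := H w (by rintro rfl; simp at hw1)
    (mem_tangentCone_of_mem_directionalNormalCone hN) v₀ hN (tendsto_nhds_unique hA hA0)
  rw [this, norm_zero] at hv01
  exact zero_ne_one hv01

end ErrorBound

/-! ### Normal cones and distances for product sets -/

noncomputable section ProductSets

/-- The hypothesis `hσ` places a copy of `C` inside `D` through `q`; pulling the normal back along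
this affine embedding, whose linear part is `π.adjoint`, applies `π` to it. -/
theorem apply_mem_regularNormalCone {Z Y : Type*} [NormedAddCommGroup Z] [InnerProductSpace ℝ Z]
    [CompleteSpace Z] [NormedAddCommGroup Y] [InnerProductSpace ℝ Y] [CompleteSpace Y]
    {D : Set Z} {C : Set Y} {π : Z →L[ℝ] Y} (hπ : ∀ q ∈ D, π q ∈ C)
    (hσ : ∀ q ∈ D, ∀ y ∈ C, q + π.adjoint (y - π q) ∈ D) {q v : Z}
    (hv : v ∈ RegularNormalCone D q) : π v ∈ RegularNormalCone C (π q) := by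
  have hf : HasFDerivAt (fun y => q + π.adjoint (y - π q)) π.adjoint (π q) :=
    (π.adjoint.hasFDerivAt.comp (π q) ((hasFDerivAt_id _).sub_const _)).const_add q
  have := adjoint_mem_regularNormalCone (v := v) hf (hπ q hv.1)
    (Eventually.of_forall (hσ q hv.1)) (by simpa using hv)
  rwa [ContinuousLinearMap.adjoint_adjoint] at this

theorem apply_mem_directionalNormalCone {Z Y : Type*} [NormedAddCommGroup Z]
    [InnerProductSpace ℝ Z] [CompleteSpace Z] [NormedAddCommGroup Y] [InnerProductSpace ℝ Y]
    [CompleteSpace Y] {D : Set Z} {C : Set Y} {π : Z →L[ℝ] Y} (hπ : ∀ q ∈ D, π q ∈ C)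
    (hσ : ∀ q ∈ D, ∀ y ∈ C, q + π.adjoint (y - π q) ∈ D) {q d v : Z}
    (hv : v ∈ DirectionalNormalCone D q d) : π v ∈ DirectionalNormalCone C (π q) (π d) := by
  obtain ⟨t, d', v', ht, hd, hv, hN⟩ := hv
  refine ⟨t, fun k => π (d' k), fun k => π (v' k), ht, (π.continuous.tendsto _).comp hd,
    (π.continuous.tendsto _).comp hv, fun k => ?_⟩
  have := apply_mem_regularNormalCone hπ hσ (hN k)
  rwa [map_add, map_smul] at this

section Prod

theorem infDist_setOf_fst_snd_le {V W : Type*} [NormedAddCommGroup V] [NormedAddCommGroup W]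
    {A : Set V} {B : Set W} (hA : A.Nonempty) (hB : B.Nonempty) (q : WithLp 2 (V × W)) :
    Metric.infDist q {r | r.fst ∈ A ∧ r.snd ∈ B} ≤
      Metric.infDist q.fst A + Metric.infDist q.snd B := by
  refine le_of_forall_pos_le_add fun ε hε => ?_
  obtain ⟨a, ha, h1⟩ := (Metric.infDist_lt_iff hA).1
    (lt_add_of_pos_right (Metric.infDist q.fst A) (half_pos hε))
  obtain ⟨b, hb, h2⟩ := (Metric.infDist_lt_iff hB).1
    (lt_add_of_pos_right (Metric.infDist q.snd B) (half_pos hε))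
  refine (Metric.infDist_le_dist_of_mem (y := WithLp.toLp 2 (a, b)) ?_).trans ?_
  · exact ⟨ha, hb⟩
  have h3 : dist q (WithLp.toLp 2 (a, b)) ≤ dist q.fst a + dist q.snd b := by
    rw [WithLp.prod_dist_eq_of_L2]
    refine Real.sqrt_le_iff.2 ⟨by positivity, ?_⟩
    have := mul_nonneg (dist_nonneg (x := q.fst) (y := a)) (dist_nonneg (x := q.snd) (y := b))
    simp only [WithLp.toLp_fst, WithLp.toLp_snd]
    nlinarith
  linarith

variable {X V W : Type*} [NormedAddCommGroup X] [InnerProductSpace ℝ X]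
  [NormedAddCommGroup V] [InnerProductSpace ℝ V] [NormedAddCommGroup W] [InnerProductSpace ℝ W]

/-- The map `x ↦ (A x, B x)` into the Euclidean product. -/
def toLpProd (A : X →L[ℝ] V) (B : X →L[ℝ] W) : X →L[ℝ] WithLp 2 (V × W) :=
  (WithLp.prodContinuousLinearEquiv 2 ℝ V W).symm.toContinuousLinearMap.comp (A.prod B)

theorem HasFDerivAt.toLp_prodMk {f : X → V} {g : X → W} {f' : X →L[ℝ] V} {g' : X →L[ℝ] W} {x : X}
    (hf : HasFDerivAt f f' x) (hg : HasFDerivAt g g' x) :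
    HasFDerivAt (fun x => WithLp.toLp 2 (f x, g x)) (toLpProd f' g') x :=
  (WithLp.prodContinuousLinearEquiv 2 ℝ V W).symm.toContinuousLinearMap.hasFDerivAt.comp x
    (hf.prodMk hg)

variable [CompleteSpace X] [CompleteSpace V] [CompleteSpace W]

theorem adjoint_toLpProd_apply (A : X →L[ℝ] V) (B : X →L[ℝ] W) (v : WithLp 2 (V × W)) :
    (toLpProd A B).adjoint v = A.adjoint v.fst + B.adjoint v.snd := by
  refine ext_inner_right ℝ fun x => ?_
  rw [inner_add_left, ContinuousLinearMap.adjoint_inner_left,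
    ContinuousLinearMap.adjoint_inner_left, ContinuousLinearMap.adjoint_inner_left]
  rfl

theorem adjoint_fstL_apply (v : V) :
    (WithLp.fstL 2 ℝ V W).adjoint v = WithLp.toLp 2 (v, 0) := by
  refine ext_inner_right ℝ fun q => ?_
  rw [ContinuousLinearMap.adjoint_inner_left]
  simp [WithLp.prod_inner_apply]

theorem adjoint_sndL_apply (w : W) :
    (WithLp.sndL 2 ℝ V W).adjoint w = WithLp.toLp 2 (0, w) := by
  refine ext_inner_right ℝ fun q => ?_
  rw [ContinuousLinearMap.adjoint_inner_left]
  simp [WithLp.prod_inner_apply]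

theorem fst_mem_directionalNormalCone {A : Set V} {B : Set W} {q d v : WithLp 2 (V × W)}
    (h : v ∈ DirectionalNormalCone {r : WithLp 2 (V × W) | r.fst ∈ A ∧ r.snd ∈ B} q d) :
    v.fst ∈ DirectionalNormalCone A q.fst d.fst := by
  refine apply_mem_directionalNormalCone (π := WithLp.fstL 2 ℝ V W) (fun q hq => hq.1) ?_ h
  intro q hq y hy
  rw [adjoint_fstL_apply]
  exact ⟨by simpa using hy, by simpa using hq.2⟩

theorem snd_mem_directionalNormalCone {A : Set V} {B : Set W} {q d v : WithLp 2 (V × W)}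
    (h : v ∈ DirectionalNormalCone {r : WithLp 2 (V × W) | r.fst ∈ A ∧ r.snd ∈ B} q d) :
    v.snd ∈ DirectionalNormalCone B q.snd d.snd := by
  refine apply_mem_directionalNormalCone (π := WithLp.sndL 2 ℝ V W) (fun q hq => hq.2) ?_ h
  intro q hq y hy
  rw [adjoint_sndL_apply]
  exact ⟨by simpa using hq.1, by simpa using hy⟩

end Prod

theorem apply_mem_tangentCone {Z Y : Type*} [NormedAddCommGroup Z] [InnerProductSpace ℝ Z]
    [NormedAddCommGroup Y] [InnerProductSpace ℝ Y] {D : Set Z} {C : Set Y} {π : Z →L[ℝ] Y}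
    (hπ : ∀ q ∈ D, π q ∈ C) {q d : Z} (hd : d ∈ TangentCone D q) :
    π d ∈ TangentCone C (π q) := by
  obtain ⟨t, d', ht, hd, hD⟩ := hd
  refine ⟨t, fun k => π (d' k), ht, (π.continuous.tendsto _).comp hd, fun k => ?_⟩
  rw [← map_smul, ← map_add]
  exact hπ _ (hD k)

/-! ### Splitting pairs of block vectors into blocks of pairs -/

variable {ι : Type*} {E : ι → Type*} [∀ i, NormedAddCommGroup (E i)]
  [∀ i, InnerProductSpace ℝ (E i)]

/-- The `i`-th block `(x i, y i)` of a pair `(x, y)` of block vectors. -/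
def blockProj (i : ι) : WithLp 2 (PiLp 2 E × PiLp 2 E) →L[ℝ] WithLp 2 (E i × E i) :=
  (WithLp.prodContinuousLinearEquiv 2 ℝ (E i) (E i)).symm.toContinuousLinearMap.comp
    (((PiLp.proj 2 E i).comp (WithLp.fstL 2 ℝ _ _)).prod
      ((PiLp.proj 2 E i).comp (WithLp.sndL 2 ℝ _ _)))

theorem blockProj_apply (i : ι) (q : WithLp 2 (PiLp 2 E × PiLp 2 E)) :
    blockProj i q = WithLp.toLp 2 (q.fst i, q.snd i) := rfl

variable [Fintype ι]

theorem sum_inner_blockProj (q r : WithLp 2 (PiLp 2 E × PiLp 2 E)) :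
    inner ℝ q r = ∑ i, inner ℝ (blockProj i q) (blockProj i r) := by
  simp only [WithLp.prod_inner_apply, PiLp.inner_apply, blockProj_apply, Finset.sum_add_distrib]
  rfl

/-- The blockwise inner products are nonnegative, so their sum vanishes only if each of them does.
-/
theorem mem_complementaritySet_pi_iff {K : ∀ i, Set (E i)}
    (hK : ∀ i, ∀ x ∈ K i, ∀ y ∈ K i, 0 ≤ inner ℝ x y) (q : WithLp 2 (PiLp 2 E × PiLp 2 E)) :
    q ∈ ComplementaritySet {x : PiLp 2 E | ∀ i, x i ∈ K i} ↔
      ∀ i, blockProj i q ∈ ComplementaritySet (K i) := by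
  constructor
  · rintro ⟨h1, h2, h3⟩ i
    rw [PiLp.inner_apply, Finset.sum_eq_zero_iff_of_nonneg
      fun i _ => hK i _ (h1 i) _ (h2 i)] at h3
    exact ⟨h1 i, h2 i, h3 i (Finset.mem_univ i)⟩
  · intro h
    refine ⟨fun i => (h i).1, fun i => (h i).2.1, ?_⟩
    rw [PiLp.inner_apply]
    exact Finset.sum_eq_zero fun i _ => (h i).2.2

variable [∀ i, CompleteSpace (E i)]

theorem sum_adjoint_blockProj (q : WithLp 2 (PiLp 2 E × PiLp 2 E)) :
    ∑ i, (blockProj i).adjoint (blockProj i q) = q := by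
  refine ext_inner_right ℝ fun r => ?_
  simp_rw [sum_inner, ContinuousLinearMap.adjoint_inner_left]
  exact (sum_inner_blockProj q r).symm

theorem mem_regularNormalCone_of_blockProj {C : ∀ i, Set (WithLp 2 (E i × E i))}
    {D : Set (WithLp 2 (PiLp 2 E × PiLp 2 E))} (hD : ∀ q, q ∈ D ↔ ∀ i, blockProj i q ∈ C i)
    {q v : WithLp 2 (PiLp 2 E × PiLp 2 E)}
    (h : ∀ i, blockProj i v ∈ RegularNormalCone (C i) (blockProj i q)) :
    v ∈ RegularNormalCone D q := by
  have hq : q ∈ D := (hD q).2 fun i => (h i).1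
  rw [← sum_adjoint_blockProj v]
  exact sum_mem_regularNormalCone hq _ fun i _ =>
    adjoint_mem_regularNormalCone (blockProj i).hasFDerivAt hq
      (Eventually.of_forall fun r hr => (hD r).1 hr i) (h i)

theorem tendsto_sum_adjoint_blockProj {u' : ∀ i, ℕ → WithLp 2 (E i × E i)}
    {u : WithLp 2 (PiLp 2 E × PiLp 2 E)}
    (hu : ∀ i, Tendsto (u' i) atTop (𝓝 (blockProj i u))) :
    Tendsto (fun k => ∑ i, (blockProj i).adjoint (u' i k)) atTop (𝓝 u) := by
  have hc : Continuous fun y : ∀ i, WithLp 2 (E i × E i) => ∑ i, (blockProj i).adjoint (y i) :=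
    continuous_finsetSum _ fun i _ =>
      (ContinuousLinearMap.continuous _).comp (continuous_apply i)
  have h := (hc.tendsto fun i => blockProj i u).comp (tendsto_pi_nhds.2 hu : Tendsto
    (fun k i => u' i k) atTop (𝓝 fun i => blockProj i u))
  rwa [sum_adjoint_blockProj] at h

variable [DecidableEq ι]

theorem adjoint_blockProj_apply (i : ι) (y : WithLp 2 (E i × E i)) :
    (blockProj i).adjoint y =
      WithLp.toLp 2 (PiLp.single 2 i y.fst, PiLp.single 2 i y.snd) := by
  refine ext_inner_right ℝ fun q => ?_
  rw [ContinuousLinearMap.adjoint_inner_left, sum_inner_blockProj, Finset.sum_eq_single i]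
  · simp [blockProj_apply]
  · intro j _ hj
    simp [blockProj_apply, hj, WithLp.prod_inner_apply]
  · simp

theorem blockProj_adjoint_blockProj_self (i : ι) (y : WithLp 2 (E i × E i)) :
    blockProj i ((blockProj i).adjoint y) = y := by
  simp [adjoint_blockProj_apply, blockProj_apply]
  rfl

theorem blockProj_adjoint_blockProj_of_ne {i j : ι} (h : j ≠ i) (y : WithLp 2 (E i × E i)) :
    blockProj j ((blockProj i).adjoint y) = 0 := by
  simp [adjoint_blockProj_apply, blockProj_apply, h]

theorem blockProj_sum_adjoint (j : ι) (y : ∀ i, WithLp 2 (E i × E i)) :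
    blockProj j (∑ i, (blockProj i).adjoint (y i)) = y j := by
  rw [map_sum, Finset.sum_eq_single j, blockProj_adjoint_blockProj_self]
  · exact fun i _ hi => blockProj_adjoint_blockProj_of_ne hi.symm _
  · simp

theorem norm_adjoint_blockProj (i : ι) (y : WithLp 2 (E i × E i)) :
    ‖(blockProj i).adjoint y‖ = ‖y‖ := by
  rw [← sq_eq_sq₀ (norm_nonneg _) (norm_nonneg _), ← real_inner_self_eq_norm_sq,
    ContinuousLinearMap.adjoint_inner_left, blockProj_adjoint_blockProj_self,
    real_inner_self_eq_norm_sq]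

variable {C : ∀ i, Set (WithLp 2 (E i × E i))} {D : Set (WithLp 2 (PiLp 2 E × PiLp 2 E))}

theorem add_adjoint_blockProj_mem (hD : ∀ q, q ∈ D ↔ ∀ i, blockProj i q ∈ C i) (i : ι) :
    ∀ q ∈ D, ∀ y ∈ C i, q + (blockProj i).adjoint (y - blockProj i q) ∈ D := by
  intro q hq y hy
  refine (hD _).2 fun j => ?_
  rw [map_add]
  by_cases h : j = i
  · subst h
    rwa [blockProj_adjoint_blockProj_self, add_sub_cancel]
  · rw [blockProj_adjoint_blockProj_of_ne h, add_zero]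
    exact (hD q).1 hq j

/-- With the step sizes fixed and shared, blockwise sequences can be chosen independently and
reassembled. -/
theorem isNormalAlong_iff_blockProj (hD : ∀ q, q ∈ D ↔ ∀ i, blockProj i q ∈ C i)
    {q d v : WithLp 2 (PiLp 2 E × PiLp 2 E)} {t : ℕ → ℝ} :
    IsNormalAlong D q t d v ↔
      ∀ i, IsNormalAlong (C i) (blockProj i q) t (blockProj i d) (blockProj i v) := by
  constructor
  · rintro ⟨d', v', hd, hv, hN⟩ i
    refine ⟨fun k => blockProj (E := E) i (d' k), fun k => blockProj (E := E) i (v' k),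
      ((blockProj (E := E) i).continuous.tendsto _).comp hd,
      ((blockProj (E := E) i).continuous.tendsto _).comp hv, ?_⟩
    filter_upwards [hN] with k hk
    have := apply_mem_regularNormalCone (fun r hr => (hD r).1 hr i)
      (add_adjoint_blockProj_mem hD i) hk
    rwa [map_add, map_smul] at this
  · intro h
    choose d' v' hd hv hN using h
    refine ⟨_, _, tendsto_sum_adjoint_blockProj hd, tendsto_sum_adjoint_blockProj hv, ?_⟩
    filter_upwards [eventually_all.2 hN] with k hk
    refine mem_regularNormalCone_of_blockProj hD fun i => ?_
    rw [map_add, map_smul, blockProj_sum_adjoint, blockProj_sum_adjoint]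
    exact hk i

theorem DirectionallyRegularAt.of_blockProj (hD : ∀ q, q ∈ D ↔ ∀ i, blockProj i q ∈ C i)
    {q : WithLp 2 (PiLp 2 E × PiLp 2 E)}
    (h : ∀ i, DirectionallyRegularAt (C i) (blockProj i q)) : DirectionallyRegularAt D q := by
  intro t s ht hs d v hN
  rw [isNormalAlong_iff_blockProj hD] at hN ⊢
  exact fun i => h i t s ht hs _ _ (hN i)

/-- From right to left, each block arrives with its own step sizes; regularity of the blocks
replaces them all by 1/(k+1). -/
theorem mem_directionalNormalCone_iff_blockProj (hD : ∀ q, q ∈ D ↔ ∀ i, blockProj i q ∈ C i)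
    {q d v : WithLp 2 (PiLp 2 E × PiLp 2 E)} (hq : q ∈ D)
    (h : ∀ i, DirectionallyRegularAt (C i) (blockProj i q)) :
    v ∈ DirectionalNormalCone D q d ↔
      ∀ i, blockProj i v ∈ DirectionalNormalCone (C i) (blockProj i q) (blockProj i d) := by
  have hqi := (hD q).1 hq
  rw [mem_directionalNormalCone_iff hq]
  simp_rw [fun i => mem_directionalNormalCone_iff (d := blockProj i d) (v := blockProj i v) (hqi i),
    isNormalAlong_iff_blockProj hD]
  constructor
  · rintro ⟨t, ht, hN⟩ i
    exact ⟨t, ht, hN i⟩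
  · intro hN
    refine ⟨_, posTendsToZero_one_div, fun i => ?_⟩
    obtain ⟨t, ht, hi⟩ := hN i
    exact h i t _ ht posTendsToZero_one_div _ _ hi

/-- Blockwise nearest points assemble to a point of `D`; the block embeddings are isometric, so the
triangle inequality suffices. -/
theorem infDist_le_sum_infDist_blockProj [∀ i, FiniteDimensional ℝ (E i)]
    (hD : ∀ q, q ∈ D ↔ ∀ i, blockProj i q ∈ C i) (hC : ∀ i, IsClosed (C i))
    (hne : ∀ i, (C i).Nonempty) (q : WithLp 2 (PiLp 2 E × PiLp 2 E)) :
    Metric.infDist q D ≤ ∑ i, Metric.infDist (blockProj i q) (C i) := by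
  choose y hy hqy using fun i => (hC i).exists_infDist_eq_dist (hne i) (blockProj i q)
  have hmem : ∑ i, (blockProj i).adjoint (y i) ∈ D :=
    (hD _).2 fun j => by rw [blockProj_sum_adjoint]; exact hy j
  refine (Metric.infDist_le_dist_of_mem hmem).trans ?_
  rw [dist_eq_norm]
  nth_rw 1 [← sum_adjoint_blockProj q]
  rw [← Finset.sum_sub_distrib]
  refine (norm_sum_le _ _).trans (Finset.sum_le_sum fun i _ => ?_)
  rw [← map_sub, norm_adjoint_blockProj, hqy, dist_eq_norm]

end ProductSets

/-! ### Second-order cones as Lorentz cones, and their products -/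

section SecondOrderCone

theorem secondOrderCone_eq_lorentzCone (p : ℕ) :
    SecondOrderCone p = lorentzCone (EuclideanSpace.single (0 : Fin (p + 1)) (1 : ℝ)) := by
  ext x
  have h1 : (inner ℝ (EuclideanSpace.single (0 : Fin (p + 1)) (1 : ℝ)) x : ℝ) = x 0 := by
    simp [EuclideanSpace.inner_single_left]
  have h2 : ‖spatialPart (EuclideanSpace.single (0 : Fin (p + 1)) (1 : ℝ)) x‖ =
      ‖(WithLp.toLp 2 (fun j : Fin p => x j.succ) : EuclideanSpace ℝ (Fin p))‖ := by
    rw [spatialPart_apply, h1, EuclideanSpace.norm_eq, EuclideanSpace.norm_eq, Fin.sum_univ_succ]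
    simp
  simp only [SecondOrderCone, lorentzCone, Set.mem_ofPred_eq, h1, h2]

theorem norm_euclideanSpace_single_zero_one (p : ℕ) :
    ‖EuclideanSpace.single (0 : Fin (p + 1)) (1 : ℝ)‖ = 1 := by simp

theorem inner_nonneg_of_mem_secondOrderCone {p : ℕ} {x y : EuclideanSpace ℝ (Fin (p + 1))}
    (hx : x ∈ SecondOrderCone p) (hy : y ∈ SecondOrderCone p) : 0 ≤ inner ℝ x y := by
  rw [secondOrderCone_eq_lorentzCone] at hx hy
  exact inner_nonneg_of_mem_lorentzCone (norm_euclideanSpace_single_zero_one p) hx hy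

theorem directionallyRegularAt_complementaritySet_secondOrderCone {p : ℕ}
    {q : WithLp 2 (EuclideanSpace ℝ (Fin (p + 1)) × EuclideanSpace ℝ (Fin (p + 1)))}
    (h : q ∈ ComplementaritySet (SecondOrderCone p)) :
    DirectionallyRegularAt (ComplementaritySet (SecondOrderCone p)) q := by
  rw [secondOrderCone_eq_lorentzCone] at h ⊢
  exact directionallyRegularAt_complementaritySet_lorentzCone
    (norm_euclideanSpace_single_zero_one p) h

theorem isClosed_complementaritySet {V : Type*} [NormedAddCommGroup V] [InnerProductSpace ℝ V]
    {K : Set V} (hK : IsClosed K) : IsClosed (ComplementaritySet K) := by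
  have h1 : Continuous fun q : WithLp 2 (V × V) => q.fst := (WithLp.fstL 2 ℝ V V).continuous
  have h2 : Continuous fun q : WithLp 2 (V × V) => q.snd := (WithLp.sndL 2 ℝ V V).continuous
  exact (hK.preimage h1).inter ((hK.preimage h2).inter
    (isClosed_eq (h1.inner h2) continuous_const))

theorem isClosed_secondOrderCone (p : ℕ) : IsClosed (SecondOrderCone p) := by
  rw [secondOrderCone_eq_lorentzCone]
  exact isClosed_lorentzCone

theorem complementaritySet_secondOrderCone_nonempty (p : ℕ) :
    (ComplementaritySet (SecondOrderCone p)).Nonempty := by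
  have h0 : (0 : EuclideanSpace ℝ (Fin (p + 1))) ∈ SecondOrderCone p := by
    rw [secondOrderCone_eq_lorentzCone]
    simp [lorentzCone]
  exact ⟨0, h0, h0, by simp⟩

variable {J : ℕ} {p : Fin J → ℕ}

theorem mem_complementaritySet_productCone_iff (q : WithLp 2 (BlockSpace p × BlockSpace p)) :
    q ∈ ComplementaritySet (ProductCone p) ↔
      ∀ i, blockProj i q ∈ ComplementaritySet (SecondOrderCone (p i)) :=
  mem_complementaritySet_pi_iff
    (fun _ _ hx _ hy => inner_nonneg_of_mem_secondOrderCone hx hy) q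

theorem isClosed_complementaritySet_productCone :
    IsClosed (ComplementaritySet (ProductCone p)) := by
  refine isClosed_complementaritySet ?_
  have : ProductCone p = ⋂ i, (PiLp.proj 2 (𝕜 := ℝ)
      (fun i => EuclideanSpace ℝ (Fin (p i + 1))) i) ⁻¹' SecondOrderCone (p i) := by
    ext x
    simp [ProductCone]
  rw [this]
  exact isClosed_iInter fun i =>
    (isClosed_secondOrderCone (p i)).preimage (ContinuousLinearMap.continuous _)

theorem directionallyRegularAt_complementaritySet_productCone
    {q : WithLp 2 (BlockSpace p × BlockSpace p)} (h : q ∈ ComplementaritySet (ProductCone p)) :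
    DirectionallyRegularAt (ComplementaritySet (ProductCone p)) q :=
  .of_blockProj mem_complementaritySet_productCone_iff fun i =>
    directionallyRegularAt_complementaritySet_secondOrderCone
      ((mem_complementaritySet_productCone_iff q).1 h i)

theorem toLp_mem_directionalNormalCone_iff_block {x y d₁ d₂ v₁ v₂ : BlockSpace p}
    (h : WithLp.toLp 2 (x, y) ∈ ComplementaritySet (ProductCone p)) :
    WithLp.toLp 2 (v₁, v₂) ∈ DirectionalNormalCone (ComplementaritySet (ProductCone p))
        (WithLp.toLp 2 (x, y)) (WithLp.toLp 2 (d₁, d₂)) ↔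
      ∀ i, WithLp.toLp 2 (v₁ i, v₂ i) ∈
        DirectionalNormalCone (ComplementaritySet (SecondOrderCone (p i)))
          (WithLp.toLp 2 (x i, y i)) (WithLp.toLp 2 (d₁ i, d₂ i)) :=
  mem_directionalNormalCone_iff_blockProj mem_complementaritySet_productCone_iff h fun i =>
    directionallyRegularAt_complementaritySet_secondOrderCone
      ((mem_complementaritySet_productCone_iff _).1 h i)

theorem block_mem_tangentCone {x y d₁ d₂ : BlockSpace p}
    (h : WithLp.toLp 2 (d₁, d₂) ∈ TangentCone (ComplementaritySet (ProductCone p))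
      (WithLp.toLp 2 (x, y))) (i : Fin J) :
    WithLp.toLp 2 (d₁ i, d₂ i) ∈ TangentCone (ComplementaritySet (SecondOrderCone (p i)))
      (WithLp.toLp 2 (x i, y i)) := by
  have hC : ∀ q ∈ ComplementaritySet (ProductCone p),
      blockProj i q ∈ ComplementaritySet (SecondOrderCone (p i)) := fun q hq =>
    (mem_complementaritySet_productCone_iff q).1 hq i
  have := apply_mem_tangentCone hC h
  rwa [blockProj_apply, blockProj_apply] at this

theorem directionallyRegular_complementaritySet_productCone :
    DirectionallyRegular (ComplementaritySet (ProductCone p)) := fun _ hz d =>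
  (directionallyRegularAt_complementaritySet_productCone hz).directionalNormalCone_eq hz d

end SecondOrderCone

/-! ### The complementarity system -/

section System

variable {n l J : ℕ} {p : Fin J → ℕ} {F : EuclideanSpace ℝ (Fin n) → EuclideanSpace ℝ (Fin l)}
  {G H : EuclideanSpace ℝ (Fin n) → BlockSpace p} {Λ : Set (EuclideanSpace ℝ (Fin l))}
  {zs : EuclideanSpace ℝ (Fin n)}

theorem fderiv_block_apply (hG : DifferentiableAt ℝ G zs) (i : Fin J)
    (w : EuclideanSpace ℝ (Fin n)) :
    fderiv ℝ (fun z => G z i) zs w = (fderiv ℝ G zs w) i := by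
  have := ((PiLp.proj 2 (𝕜 := ℝ) (fun i => EuclideanSpace ℝ (Fin (p i + 1))) i).hasFDerivAt.comp
    zs hG.hasFDerivAt).fderiv
  exact congrArg (fun L : EuclideanSpace ℝ (Fin n) →L[ℝ] _ => L w) this

theorem sum_adjoint_fderiv_block (hG : DifferentiableAt ℝ G zs) (lG : BlockSpace p) :
    ∑ i, (fderiv ℝ (fun z => G z i) zs).adjoint (lG i) = (fderiv ℝ G zs).adjoint lG := by
  refine ext_inner_right ℝ fun w => ?_
  simp_rw [sum_inner, ContinuousLinearMap.adjoint_inner_left, fderiv_block_apply hG]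
  rw [PiLp.inner_apply]

/-- Joint tangency implies blockwise tangency directly. For the converse no splitting of tangent
cones is needed: the multipliers form a joint directional normal, and a direction admitting one is
automatically tangent. -/
theorem componentwiseFOSCMS_iff_jointFOSCMS (hG : DifferentiableAt ℝ G zs)
    (hH : DifferentiableAt ℝ H zs) (hzs : zs ∈ SolutionSet F G H Λ) :
    ComponentwiseFOSCMS F G H Λ zs ↔ JointFOSCMS F G H Λ zs := by
  have hmem : WithLp.toLp 2 (G zs, H zs) ∈ ComplementaritySet (ProductCone p) :=
    ⟨hzs.1, hzs.2.1, hzs.2.2.1⟩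
  have hsum : ∀ (lF : EuclideanSpace ℝ (Fin l)) (lG lH : BlockSpace p),
      (fderiv ℝ F zs).adjoint lF +
        ∑ i, ((fderiv ℝ (fun z => G z i) zs).adjoint (lG i) +
          (fderiv ℝ (fun z => H z i) zs).adjoint (lH i)) =
      (fderiv ℝ F zs).adjoint lF + (fderiv ℝ G zs).adjoint lG + (fderiv ℝ H zs).adjoint lH := by
    intro lF lG lH
    rw [Finset.sum_add_distrib, sum_adjoint_fderiv_block hG, sum_adjoint_fderiv_block hH, add_assoc]
  simp only [ComponentwiseFOSCMS, JointFOSCMS, hsum, fderiv_block_apply hG, fderiv_block_apply hH]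
  refine forall₃_congr fun w _ _ => ⟨fun h hw lF lG lH h0 hlF hl => ?_,
    fun h _ lF lG lH h0 hlF hl => ?_⟩
  · exact h (block_mem_tangentCone hw) lF lG lH h0 hlF
      ((toLp_mem_directionalNormalCone_iff_block hmem).1 hl)
  · have hl' := (toLp_mem_directionalNormalCone_iff_block hmem).2 hl
    exact h (mem_tangentCone_of_mem_directionalNormalCone hl') lF lG lH h0 hlF hl'

theorem infDist_complementaritySet_productCone_le (q : WithLp 2 (BlockSpace p × BlockSpace p)) :
    Metric.infDist q (ComplementaritySet (ProductCone p)) ≤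
      ∑ i, Metric.infDist (WithLp.toLp 2 (q.fst i, q.snd i))
        (ComplementaritySet (SecondOrderCone (p i))) :=
  infDist_le_sum_infDist_blockProj mem_complementaritySet_productCone_iff
    (fun i => isClosed_complementaritySet (isClosed_secondOrderCone (p i)))
    (fun i => complementaritySet_secondOrderCone_nonempty (p i)) q

/-- The abstract error bound is applied to the map (F, (G, H)) and the set Λ × Ω. Only the
projection of directional normals to the two factors is needed, so no regularity of Λ enters. -/
theorem JointFOSCMS.hasLocalErrorBound (hF : ContDiff ℝ 1 F) (hG : ContDiff ℝ 1 G)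
    (hH : ContDiff ℝ 1 H) (hΛ : IsClosed Λ) (hzs : zs ∈ SolutionSet F G H Λ)
    (h : JointFOSCMS F G H Λ zs) : HasLocalErrorBound F G H Λ zs := by
  set Ω := ComplementaritySet (ProductCone p)
  set D : Set (WithLp 2 (EuclideanSpace ℝ (Fin l) × WithLp 2 (BlockSpace p × BlockSpace p))) :=
    {r | r.fst ∈ Λ ∧ r.snd ∈ Ω}
  set g : EuclideanSpace ℝ (Fin n) →
      WithLp 2 (EuclideanSpace ℝ (Fin l) × WithLp 2 (BlockSpace p × BlockSpace p)) :=
    fun z => WithLp.toLp 2 (F z, WithLp.toLp 2 (G z, H z)) with hgdef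
  have hg : ContDiff ℝ 1 g := contDiff_iff_contDiffAt.2 fun z =>
    hF.contDiffAt.toLp_prodMk (hG.contDiffAt.toLp_prodMk hH.contDiffAt)
  have hg' : fderiv ℝ g zs =
      toLpProd (fderiv ℝ F zs) (toLpProd (fderiv ℝ G zs) (fderiv ℝ H zs)) :=
    ((hF.differentiable one_ne_zero zs).hasFDerivAt.toLp_prodMk
      ((hG.differentiable one_ne_zero zs).hasFDerivAt.toLp_prodMk
        (hH.differentiable one_ne_zero zs).hasFDerivAt)).fderiv
  have hD : IsClosed D := (hΛ.preimage (WithLp.fstL 2 ℝ _ _).continuous).inter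
    (isClosed_complementaritySet_productCone.preimage (WithLp.sndL 2 ℝ _ _).continuous)
  have hmem : WithLp.toLp 2 (G zs, H zs) ∈ Ω := ⟨hzs.1, hzs.2.1, hzs.2.2.1⟩
  have hS : SolutionSet F G H Λ = g ⁻¹' D := by
    ext z
    exact ⟨fun h => ⟨h.2.2.2, h.1, h.2.1, h.2.2.1⟩, fun h => ⟨h.2.1, h.2.2.1, h.2.2.2, h.1⟩⟩
  obtain ⟨κ, hκ, U, hU, hbound⟩ := exists_errorBound_of_firstOrderCondition hg hD
    (zs := zs) ⟨hzs.2.2.2, hmem⟩ (by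
      intro w hw hT v hv h0
      rw [hg'] at hT hv h0
      rw [adjoint_toLpProd_apply, adjoint_toLpProd_apply, ← add_assoc] at h0
      have h1 := fst_mem_directionalNormalCone hv
      have h2 := snd_mem_directionalNormalCone hv
      obtain ⟨e1, e2, e3⟩ := h w hw (mem_tangentCone_of_mem_directionalNormalCone h1)
        (mem_tangentCone_of_mem_directionalNormalCone h2) v.fst v.snd.fst v.snd.snd h0 h1 h2
      have e4 : v.snd = 0 := (WithLp.ofLp_injective 2) (Prod.ext e2 e3)
      exact (WithLp.ofLp_injective 2) (Prod.ext e1 e4))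
  refine ⟨κ, hκ, U, hU, fun z hz => ?_⟩
  rw [hS]
  refine (hbound z hz).trans (mul_le_mul_of_nonneg_left ?_ hκ.le)
  refine (infDist_setOf_fst_snd_le ⟨_, hzs.2.2.2⟩ ⟨_, hmem⟩ (g z)).trans ?_
  exact add_le_add_right (infDist_complementaritySet_productCone_le _) _

end System

theorem mainTheorem4 {n l J : ℕ} (p : Fin J → ℕ)
    (F : EuclideanSpace ℝ (Fin n) → EuclideanSpace ℝ (Fin l))
    (G H : EuclideanSpace ℝ (Fin n) → BlockSpace p)
    (Λ : Set (EuclideanSpace ℝ (Fin l)))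
    (hF : ContDiff ℝ 1 F) (hG : ContDiff ℝ 1 G) (hH : ContDiff ℝ 1 H) (hΛ : IsClosed Λ)
    (zs : EuclideanSpace ℝ (Fin n)) (hzs : zs ∈ SolutionSet F G H Λ) :
    (ComponentwiseFOSCMS F G H Λ zs → HasLocalErrorBound F G H Λ zs) ∧
    (ComponentwiseFOSCMS F G H Λ zs ↔ JointFOSCMS F G H Λ zs) ∧
    DirectionallyRegular (ComplementaritySet (ProductCone p)) := by
  have hiff := componentwiseFOSCMS_iff_jointFOSCMS (hG.differentiable one_ne_zero zs)
    (hH.differentiable one_ne_zero zs) hzs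
  exact ⟨fun h => (hiff.1 h).hasLocalErrorBound hF hG hH hΛ hzs, hiff,
    directionallyRegular_complementaritySet_productCone⟩
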